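/- Theorem 1.1. Let $G$ and $K$ be stable rational matrix functions (rational, no poles in the closed unit disc) of sizes $m\times p$ and $m\times q$, given by an observable stable realization $$[\,G(z)\;\;K(z)\,]=[\,D_1\;\;D_2\,]+zC(I_n-zA)^{-1}[\,B_1\;\;B_2\,],$$ that is, all eigenvalues of the $n\times n$ matrix $A$ lie in the open unit disc and the observability operator $W_{obs}:\mathbb C^n\to\ell^2_+(\mathbb C^m)$, $W_{obs}x=(Cx,CAx,CA^2x,\dots)$, is one-to-one. Write $T_F$ for the (block) Toeplitz operator with symbol $F$, acting between $\ell^2_+$-spaces of vector sequences; an operator or matrix is called strictly positive, written $>0$, if it is positive (semidefinite) and boundedly invertible. Let $R(z)=G(z)G(\bar z^{-1})^*-K(z)K(\bar z^{-1})^*$, let $P_1,P_2$ be the unique solutions of the Stein equations $P_j-AP_jA^*=B_jB_j^*$ $(j=1,2)$, and set $$R_0=D_1D_1^*-D_2D_2^*+C(P_1-P_2)C^*,\qquad \Gamma=B_1D_1^*-B_2D_2^*+A(P_1-P_2)C^*.$$ Then $T_GT_G^*-T_KT_K^*$ is strictly positive if and only if the following two conditions hold: (i) there exists a strictly positive $n\times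 n$ matrix $Q$ such that (a) $R_0-\Gamma^*Q\Gamma>0$; (b) $Q$ satisfies the Riccati equation $$Q=A^*QA+(C-\Gamma^*QA)^*(R_0-\Gamma^*Q\Gamma)^{-1}(C-\Gamma^*QA);$$ (c) all eigenvalues of $A_0=A-\Gamma(R_0-\Gamma^*Q\Gamma)^{-1}(C-\Gamma^*QA)$ lie in the open unit disc; (ii) for this $Q$, $Q^{-1}+P_2-P_1>0$. In this case $T_R$ is strictly positive, and for every $Q$ as in (i), condition (ii) holds, the matrix $I+Q(P_2-P_1)$ is invertible, and $$(T_GT_G^*-T_KT_K^*)^{-1}=T_R^{-1}+T_R^{-1}W_{obs}\,\Omega\,W_{obs}^*T_R^{-1},$$ where $$\Omega=(P_1-P_2)(Q^{-1}+P_2-P_1)^{-1}Q^{-1}=(P_1-P_2)\bigl(I+Q(P_2-P_1)\bigr)^{-1}.$$ -/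

import Mathlib

open scoped Matrix ComplexConjugate ComplexOrder

namespace Leech

noncomputable section

/-- The Hilbert space of square summable unilateral sequences of vectors in `ℂ^k`. -/
abbrev Seq (k : ℕ) : Type := lp (fun _ : ℕ => EuclideanSpace ℂ (Fin k)) 2

/-- A square matrix is stable if all its eigenvalues lie in the open unit disc. -/
def IsStable {n : ℕ} (A : Matrix (Fin n) (Fin n) ℂ) : Prop :=
  ∀ μ ∈ spectrum ℂ A, ‖μ‖ < 1

/-- A matrix function is stable rational if each entry is a quotient of polynomials without poles
in the closed unit disc. -/
def IsStableRational {k r : ℕ} (F : ℂ → Matrix (Fin k) (Fin r) ℂ) : Prop :=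
  ∀ i j, ∃ a b : Polynomial ℂ, (∀ z : ℂ, ‖z‖ ≤ 1 → b.eval z ≠ 0) ∧
    ∀ z : ℂ, b.eval z ≠ 0 → F z i j = a.eval z / b.eval z

/-- The identity `[G(z) K(z)] = [D₁ D₂] + z C (I - z A)⁻¹ [B₁ B₂]`. For stable `A` and stable
rational `G`, `K` both sides are rational without poles in the closed unit disc, so that equality
there is equality as rational functions. -/
def IsRealization {m n p q : ℕ} (G : ℂ → Matrix (Fin m) (Fin p) ℂ)
    (K : ℂ → Matrix (Fin m) (Fin q) ℂ) (A : Matrix (Fin n) (Fin n) ℂ)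
    (B₁ : Matrix (Fin n) (Fin p) ℂ) (B₂ : Matrix (Fin n) (Fin q) ℂ)
    (C : Matrix (Fin m) (Fin n) ℂ)
    (D₁ : Matrix (Fin m) (Fin p) ℂ) (D₂ : Matrix (Fin m) (Fin q) ℂ) : Prop :=
  ∀ z : ℂ, ‖z‖ ≤ 1 → Matrix.fromCols (G z) (K z) =
    Matrix.fromCols D₁ D₂ + z • (C * (1 - z • A)⁻¹ * Matrix.fromCols B₁ B₂)

/-! ### Toeplitz operators -/

/-- The Fourier coefficient `(1/2π) ∫₀^{2π} e^{-ikθ} F(e^{iθ}) dθ`, taken entrywise. -/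
def fourierCoef {k r : ℕ} (F : ℂ → Matrix (Fin k) (Fin r) ℂ) (l : ℤ) :
    Matrix (Fin k) (Fin r) ℂ :=
  Matrix.of fun i j => Real.circleAverage (fun z : ℂ => z ^ (-l) * F z i j) 0 1

/-- `T` is the bounded operator given by the block matrix `(F_{i-j})_{i,j ≥ 0}`, with `F_l` the
Fourier coefficients of `F`. -/
def IsToeplitz {k r : ℕ} (F : ℂ → Matrix (Fin k) (Fin r) ℂ) (T : Seq r →L[ℂ] Seq k) : Prop :=
  ∀ (x : Seq r) (i : ℕ), HasSum
    (fun j : ℕ => Matrix.toEuclideanLin (fourierCoef F ((i : ℤ) - (j : ℤ))) (x j)) (T x i)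

open Classical in
/-- The Toeplitz operator with symbol `F` (zero if the block Toeplitz matrix of `F` does not
define a bounded operator, which does not happen for a symbol bounded on the unit circle; see
`IsStableRational.isToeplitz` and `isToeplitz_symbolR` for the symbols used below). -/
def toeplitz {k r : ℕ} (F : ℂ → Matrix (Fin k) (Fin r) ℂ) : Seq r →L[ℂ] Seq k :=
  if h : ∃ T, IsToeplitz F T then h.choose else 0

theorem IsToeplitz.unique {k r : ℕ} {F : ℂ → Matrix (Fin k) (Fin r) ℂ}
    {T S : Seq r →L[ℂ] Seq k} (hT : IsToeplitz F T) (hS : IsToeplitz F S) : T = S := by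
  ext1 x
  apply lp.ext
  funext i
  exact (hT x i).unique (hS x i)

theorem isToeplitz_toeplitz {k r : ℕ} {F : ℂ → Matrix (Fin k) (Fin r) ℂ}
    (h : ∃ T, IsToeplitz F T) : IsToeplitz F (toeplitz F) := by
  unfold toeplitz
  rw [dif_pos h]
  exact h.choose_spec

theorem IsToeplitz.toeplitz_eq {k r : ℕ} {F : ℂ → Matrix (Fin k) (Fin r) ℂ}
    {T : Seq r →L[ℂ] Seq k} (hT : IsToeplitz F T) : toeplitz F = T :=
  (isToeplitz_toeplitz ⟨T, hT⟩).unique hT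

/-- Translation of a unilateral sequence by the integer `l`. -/
def shiftFun {r : ℕ} (l : ℤ) (x : ℕ → EuclideanSpace ℂ (Fin r)) (i : ℕ) :
    EuclideanSpace ℂ (Fin r) :=
  if 0 ≤ (i : ℤ) - l then x ((i : ℤ) - l).toNat else 0

theorem sum_shiftFun_le {r : ℕ} (l : ℤ) (x : Seq r) (s : Finset ℕ) :
    ∑ i ∈ s, ‖shiftFun l x i‖ ^ (2 : ENNReal).toReal ≤ ‖x‖ ^ (2 : ENNReal).toReal := by
  classical
  have h2 : (0 : ℝ) < (2 : ENNReal).toReal := by norm_num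
  rw [← Finset.sum_filter_add_sum_filter_not s (fun i : ℕ => 0 ≤ (i : ℤ) - l)]
  rw [Finset.sum_eq_zero (s := s.filter (fun i : ℕ => ¬ 0 ≤ (i : ℤ) - l)), add_zero]
  · calc _ = ∑ i ∈ s.filter (fun i : ℕ => 0 ≤ (i : ℤ) - l),
          ‖x ((i : ℤ) - l).toNat‖ ^ (2 : ENNReal).toReal := by
          refine Finset.sum_congr rfl fun i hi => ?_
          simp only [shiftFun, if_pos (Finset.mem_filter.1 hi).2]
      _ = ∑ j ∈ (s.filter (fun i : ℕ => 0 ≤ (i : ℤ) - l)).image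
            (fun i : ℕ => ((i : ℤ) - l).toNat), ‖x j‖ ^ (2 : ENNReal).toReal := by
          rw [Finset.sum_image]
          intro a ha b hb hab
          have ha' := (Finset.mem_filter.1 ha).2
          have hb' := (Finset.mem_filter.1 hb).2
          simp only at hab
          omega
      _ ≤ _ := lp.sum_rpow_le_norm_rpow h2 x _
  · intro i hi
    simp only [shiftFun, if_neg (Finset.mem_filter.1 hi).2, norm_zero]
    exact Real.zero_rpow h2.ne'

/-- `shiftFun` as a linear map on square summable sequences. -/
def shiftLin {r : ℕ} (l : ℤ) : Seq r →ₗ[ℂ] Seq r where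
  toFun x := ⟨shiftFun l x, memℓp_gen' (sum_shiftFun_le l x)⟩
  map_add' x y := by
    apply lp.ext
    funext i
    change shiftFun l _ i = shiftFun l _ i + shiftFun l _ i
    unfold shiftFun
    split_ifs <;> simp
  map_smul' c x := by
    apply lp.ext
    funext i
    change shiftFun l _ i = c • shiftFun l _ i
    unfold shiftFun
    split_ifs <;> simp

/-- A matrix as a continuous linear map. -/
def coefLin {k r : ℕ} (M : Matrix (Fin k) (Fin r) ℂ) :
    EuclideanSpace ℂ (Fin r) →L[ℂ] EuclideanSpace ℂ (Fin k) :=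
  LinearMap.toContinuousLinearMap (Matrix.toEuclideanLin M)

theorem norm_coefLin_le {k r : ℕ} (M : Matrix (Fin k) (Fin r) ℂ) :
    ‖coefLin M‖ ≤ ∑ i, ∑ j, ‖M i j‖ * ‖coefLin (Matrix.single i j (1 : ℂ))‖ := by
  have h : coefLin M = ∑ i, ∑ j, M i j • coefLin (Matrix.single i j (1 : ℂ)) := by
    conv_lhs => rw [Matrix.matrix_eq_sum_single M]
    simp only [coefLin, map_sum]
    refine Finset.sum_congr rfl fun i _ => Finset.sum_congr rfl fun j _ => ?_
    rw [← map_smul, ← map_smul, Matrix.smul_single, smul_eq_mul, mul_one]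
  rw [h]
  refine (norm_sum_le _ _).trans (Finset.sum_le_sum fun i _ => ?_)
  refine (norm_sum_le _ _).trans (Finset.sum_le_sum fun j _ => ?_)
  rw [norm_smul]

theorem sum_diag_le {k r : ℕ} (L : EuclideanSpace ℂ (Fin r) →L[ℂ] EuclideanSpace ℂ (Fin k))
    (x : Seq r) (s : Finset ℕ) :
    ∑ i ∈ s, ‖L (x i)‖ ^ (2 : ENNReal).toReal ≤ (‖L‖ * ‖x‖) ^ (2 : ENNReal).toReal := by
  have h2 : (0 : ℝ) < (2 : ENNReal).toReal := by norm_num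
  calc _ ≤ ∑ i ∈ s, ‖L‖ ^ (2 : ENNReal).toReal * ‖x i‖ ^ (2 : ENNReal).toReal := by
        refine Finset.sum_le_sum fun i _ => ?_
        rw [← Real.mul_rpow (norm_nonneg _) (norm_nonneg _)]
        exact Real.rpow_le_rpow (norm_nonneg _) (L.le_opNorm _) h2.le
    _ ≤ _ := by
        rw [← Finset.mul_sum, Real.mul_rpow (norm_nonneg _) (norm_nonneg _)]
        exact mul_le_mul_of_nonneg_left (lp.sum_rpow_le_norm_rpow h2 x s)
          (Real.rpow_nonneg (norm_nonneg _) _)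

/-- A linear map applied to each term of a sequence. -/
def diagLin {k r : ℕ} (L : EuclideanSpace ℂ (Fin r) →L[ℂ] EuclideanSpace ℂ (Fin k)) :
    Seq r →ₗ[ℂ] Seq k where
  toFun x := ⟨fun i => L (x i), memℓp_gen' (sum_diag_le L x)⟩
  map_add' x y := by
    apply lp.ext
    funext i
    exact map_add L _ _
  map_smul' c x := by
    apply lp.ext
    funext i
    exact map_smul L _ _

theorem norm_shiftLin_le {r : ℕ} (l : ℤ) (x : Seq r) : ‖shiftLin l x‖ ≤ ‖x‖ :=
  lp.norm_le_of_forall_sum_le (by norm_num) (norm_nonneg _) (sum_shiftFun_le l x)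

theorem norm_diagLin_le {k r : ℕ}
    (L : EuclideanSpace ℂ (Fin r) →L[ℂ] EuclideanSpace ℂ (Fin k)) (x : Seq r) :
    ‖diagLin L x‖ ≤ ‖L‖ * ‖x‖ :=
  lp.norm_le_of_forall_sum_le (by norm_num) (by positivity) (sum_diag_le L x)

/-- The operator with the single nonzero block diagonal `i - j = l`, constantly equal to `L`. -/
def layer {k r : ℕ} (L : EuclideanSpace ℂ (Fin r) →L[ℂ] EuclideanSpace ℂ (Fin k))
    (l : ℤ) : Seq r →L[ℂ] Seq k :=
  (diagLin L).mkContinuous ‖L‖ (norm_diagLin_le L) ∘L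
    (shiftLin l).mkContinuous 1 fun x => by simpa using norm_shiftLin_le l x

theorem norm_layer_le {k r : ℕ} (L : EuclideanSpace ℂ (Fin r) →L[ℂ] EuclideanSpace ℂ (Fin k))
    (l : ℤ) : ‖layer L l‖ ≤ ‖L‖ := by
  refine (ContinuousLinearMap.opNorm_comp_le _ _).trans ?_
  refine (mul_le_mul (LinearMap.mkContinuous_norm_le _ (norm_nonneg _) _)
    (LinearMap.mkContinuous_norm_le _ zero_le_one _) (norm_nonneg _) (norm_nonneg _)).trans ?_
  rw [mul_one]

theorem layer_apply {k r : ℕ} (L : EuclideanSpace ℂ (Fin r) →L[ℂ] EuclideanSpace ℂ (Fin k))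
    (l : ℤ) (x : Seq r) (i : ℕ) : layer L l x i = L (shiftFun l x i) := rfl

theorem hasSum_lp_apply {k r : ℕ} {f : ℤ → (Seq r →L[ℂ] Seq k)} {T : Seq r →L[ℂ] Seq k}
    (h : HasSum f T) (x : Seq r) (i : ℕ) : HasSum (fun l => f l x i) (T x i) := by
  have h1 : HasSum (fun l => f l x) (T x) := (ContinuousLinearMap.apply ℂ (Seq k) x).hasSum h
  exact (lp.evalCLM ℂ (fun _ : ℕ => EuclideanSpace ℂ (Fin k)) 2 i).hasSum h1

/-- The block Toeplitz matrix of a symbol with absolutely summable Fourier coefficients defines a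
bounded operator. -/
theorem exists_isToeplitz {k r : ℕ} {F : ℂ → Matrix (Fin k) (Fin r) ℂ}
    (hF : ∀ i j, Summable fun l : ℤ => ‖fourierCoef F l i j‖) : ∃ T, IsToeplitz F T := by
  have hc : Summable fun l => ‖coefLin (fourierCoef F l)‖ :=
    Summable.of_nonneg_of_le (fun _ => norm_nonneg _) (fun l => norm_coefLin_le _)
      (summable_sum (s := Finset.univ) fun i (_ : i ∈ Finset.univ) =>
        summable_sum (s := Finset.univ) fun j (_ : j ∈ Finset.univ) =>
          (hF i j).mul_right ‖coefLin (Matrix.single i j (1 : ℂ))‖)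
  have hs : Summable fun l => layer (coefLin (fourierCoef F l)) l :=
    Summable.of_norm_bounded hc fun l => norm_layer_le _ _
  refine ⟨∑' l, layer (coefLin (fourierCoef F l)) l, fun x i => ?_⟩
  have h1 := hasSum_lp_apply hs.hasSum x i
  simp only [layer_apply] at h1
  have hinj : Function.Injective fun j : ℕ => (i : ℤ) - (j : ℤ) := fun a b h => by
    simp only at h
    omega
  rw [← hinj.hasSum_iff] at h1
  · refine h1.congr_fun fun j => ?_
    have h2 : shiftFun ((i : ℤ) - (j : ℤ)) x i = x j := by
      have : (i : ℤ) - ((i : ℤ) - (j : ℤ)) = (j : ℤ) := by ring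
      simp only [shiftFun, this, Int.natCast_nonneg, if_true, Int.toNat_natCast]
    simp only [Function.comp_apply, h2]
    rfl
  · intro l hl
    have : ¬ 0 ≤ (i : ℤ) - l := fun h => hl ⟨((i : ℤ) - l).toNat, by simp only; omega⟩
    simp only [shiftFun, if_neg this, map_zero]

/-- Restriction of a stable rational function to the unit circle is smooth. -/
theorem IsStableRational.contDiff {k r : ℕ} {F : ℂ → Matrix (Fin k) (Fin r) ℂ}
    (hF : IsStableRational F) (i : Fin k) (j : Fin r) :
    ContDiff ℝ 2 fun θ : ℝ => F (circleMap 0 1 θ) i j := by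
  obtain ⟨a, b, hb, hab⟩ := hF i j
  have hn : ∀ θ : ℝ, b.eval (circleMap 0 1 θ) ≠ 0 := fun θ => hb _ (by simp)
  have h1 : ∀ c : Polynomial ℂ, ContDiff ℝ 2 fun θ : ℝ => c.eval (circleMap 0 1 θ) := fun c => by
    have hc : ContDiff ℂ 2 fun z : ℂ => c.eval z := by
      simpa using c.contDiff_aeval (𝕜 := ℂ) 2
    exact (hc.restrict_scalars ℝ).comp (contDiff_circleMap 0 1)
  have h2 : (fun θ : ℝ => F (circleMap 0 1 θ) i j)
      = fun θ : ℝ => a.eval (circleMap 0 1 θ) * (b.eval (circleMap 0 1 θ))⁻¹ := by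
    funext θ
    rw [hab _ (hn θ), div_eq_mul_inv]
  rw [h2]
  exact (h1 a).mul ((h1 b).inv hn)

theorem fourier_parts {g : ℝ → ℂ} (hg : ContDiff ℝ 1 g)
    (hper : g (2 * Real.pi) = g 0) (l : ℤ) :
    ∫ θ in (0 : ℝ)..2 * Real.pi, circleMap 0 1 θ ^ (-l) * deriv g θ
      = (l * Complex.I) * ∫ θ in (0 : ℝ)..2 * Real.pi, circleMap 0 1 θ ^ (-l) * g θ := by
  have hu : ∀ θ : ℝ, HasDerivAt (fun θ : ℝ => circleMap 0 1 θ ^ (-l))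
      (-(l * Complex.I) * circleMap 0 1 θ ^ (-l)) θ := fun θ => by
    have h0 : circleMap 0 1 θ ≠ 0 := circleMap_ne_center one_ne_zero
    have h := (hasDerivAt_zpow (-l) (circleMap 0 1 θ) (Or.inl h0)).comp θ
      (hasDerivAt_circleMap 0 1 θ)
    refine h.congr_deriv ?_
    rw [zpow_sub_one₀ h0]
    field_simp
    push_cast
    ring
  have hcu : Continuous fun θ : ℝ => circleMap 0 1 θ ^ (-l) :=
    continuous_iff_continuousAt.2 fun θ => (hu θ).continuousAt
  have hcd : Continuous (deriv g) := hg.continuous_deriv le_rfl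
  rw [intervalIntegral.integral_mul_deriv_eq_deriv_mul (fun θ _ => hu θ)
    (fun θ _ => (hg.differentiable one_ne_zero θ).hasDerivAt)
    ((continuous_const.mul hcu).intervalIntegrable _ _) (hcd.intervalIntegrable _ _)]
  have h1 : circleMap 0 1 (2 * Real.pi) = circleMap 0 1 0 := by
    simpa using periodic_circleMap 0 1 0
  rw [h1, hper, sub_self, zero_sub, ← intervalIntegral.integral_neg,
    ← intervalIntegral.integral_const_mul]
  congr 1
  funext θ
  ring

/-- A block Toeplitz matrix with a symbol that is smooth on the unit circle is bounded. -/
theorem exists_isToeplitz_of_contDiff {k r : ℕ} {F : ℂ → Matrix (Fin k) (Fin r) ℂ}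
    (hF : ∀ i j, ContDiff ℝ 2 fun θ : ℝ => F (circleMap 0 1 θ) i j) :
    ∃ T, IsToeplitz F T := by
  refine exists_isToeplitz fun i j => ?_
  set g : ℝ → ℂ := fun θ => F (circleMap 0 1 θ) i j with hgdef
  have hg : ContDiff ℝ 2 g := hF i j
  have hg' : ContDiff ℝ 1 (deriv g) := by
    have h : ContDiff ℝ (1 + 1) g := by simpa [one_add_one_eq_two] using hg
    exact (contDiff_succ_iff_deriv.1 h).2.2
  have hper : ∀ θ, g (θ + 2 * Real.pi) = g θ := fun θ => by
    simp only [hgdef, periodic_circleMap 0 1 θ]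
  have hper' : deriv g (2 * Real.pi) = deriv g 0 := by
    have h : (fun θ => g (θ + 2 * Real.pi)) = g := funext hper
    have h2 := deriv_comp_add_const g (2 * Real.pi) 0
    rw [h, zero_add] at h2
    exact h2.symm
  have hcd : Continuous (deriv (deriv g)) := hg'.continuous_deriv le_rfl
  obtain ⟨M, hM⟩ := (isCompact_Icc (a := (0 : ℝ)) (b := 2 * Real.pi)).exists_bound_of_continuousOn
    hcd.continuousOn
  have hpi := Real.pi_pos
  have hcoef : ∀ l : ℤ, l ≠ 0 → ‖fourierCoef F l i j‖ ≤ M * (1 / (l : ℝ) ^ 2) := fun l hl => by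
    have h1 := fourier_parts (hg.of_le one_le_two) (by simpa using hper 0) l
    have h2 := fourier_parts hg' hper' l
    rw [h1] at h2
    have h3 : ‖∫ θ in (0 : ℝ)..2 * Real.pi, circleMap 0 1 θ ^ (-l) * deriv (deriv g) θ‖
        ≤ M * |2 * Real.pi - 0| := by
      refine intervalIntegral.norm_integral_le_of_norm_le_const fun θ hθ => ?_
      rw [Set.uIoc_of_le (by positivity)] at hθ
      rw [norm_mul, norm_zpow, norm_circleMap_zero, abs_one, one_zpow, one_mul]
      exact hM θ ⟨hθ.1.le, hθ.2⟩
    have h5 : ‖(l : ℂ) * Complex.I‖ = |(l : ℝ)| := by simp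
    rw [h2, norm_mul ((l : ℂ) * Complex.I), norm_mul ((l : ℂ) * Complex.I), h5,
      sub_zero, abs_of_pos (by positivity : 0 < 2 * Real.pi)] at h3
    have h4 : fourierCoef F l i j
        = (2 * Real.pi)⁻¹ • ∫ θ in (0 : ℝ)..2 * Real.pi, circleMap 0 1 θ ^ (-l) * g θ := rfl
    have hl2 : (0 : ℝ) < (l : ℝ) ^ 2 := by positivity
    rw [h4, norm_smul, norm_inv, Real.norm_eq_abs, abs_of_pos (by positivity : 0 < 2 * Real.pi),
      mul_one_div, le_div_iff₀ hl2, inv_mul_eq_div, div_mul_eq_mul_div,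
      div_le_iff₀ (by positivity), ← sq_abs]
    linarith
  have hsum : Summable fun l : ℤ => M * (1 / (l : ℝ) ^ 2) :=
    (Real.summable_one_div_int_pow.2 one_lt_two).mul_left M
  refine Summable.of_norm_bounded_eventually hsum ?_
  filter_upwards [(Set.finite_singleton (0 : ℤ)).compl_mem_cofinite] with l hl
  rw [norm_norm]
  exact hcoef l hl

theorem IsStableRational.isToeplitz {k r : ℕ} {F : ℂ → Matrix (Fin k) (Fin r) ℂ}
    (hF : IsStableRational F) : IsToeplitz F (toeplitz F) :=
  isToeplitz_toeplitz (exists_isToeplitz_of_contDiff hF.contDiff)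

/-- `R(z) = G(z) G^*(z) - K(z) K^*(z)`, where `F^*(z) = F(1 / z̄)^*`. -/
def symbolR {m p q : ℕ} (G : ℂ → Matrix (Fin m) (Fin p) ℂ)
    (K : ℂ → Matrix (Fin m) (Fin q) ℂ) (z : ℂ) : Matrix (Fin m) (Fin m) ℂ :=
  G z * (G ((conj z)⁻¹))ᴴ - K z * (K ((conj z)⁻¹))ᴴ

theorem isToeplitz_symbolR {m p q : ℕ} {G : ℂ → Matrix (Fin m) (Fin p) ℂ}
    {K : ℂ → Matrix (Fin m) (Fin q) ℂ} (hG : IsStableRational G) (hK : IsStableRational K) :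
    IsToeplitz (symbolR G K) (toeplitz (symbolR G K)) := by
  refine isToeplitz_toeplitz (exists_isToeplitz_of_contDiff fun i j => ?_)
  have hz : ∀ θ : ℝ, (conj (circleMap 0 1 θ))⁻¹ = circleMap 0 1 θ := fun θ => by
    rw [Complex.inv_def, Complex.conj_conj, Complex.normSq_conj, Complex.normSq_eq_norm_sq]
    simp
  have hs : ∀ {r : ℕ} {F : ℂ → Matrix (Fin m) (Fin r) ℂ}, IsStableRational F →
      ContDiff ℝ 2 fun θ : ℝ => ∑ s, F (circleMap 0 1 θ) i s * conj (F (circleMap 0 1 θ) j s) :=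
    fun hF => ContDiff.sum fun s _ =>
      (hF.contDiff i s).mul (Complex.conjCLE.contDiff.comp (hF.contDiff j s))
  simp only [symbolR, hz, Matrix.sub_apply, Matrix.mul_apply, Matrix.conjTranspose_apply]
  exact (hs hG).sub (hs hK)

/-- The operator `T_G T_G^* - T_K T_K^*`. -/
def leechOp {m p q : ℕ} (G : ℂ → Matrix (Fin m) (Fin p) ℂ)
    (K : ℂ → Matrix (Fin m) (Fin q) ℂ) : Seq m →L[ℂ] Seq m :=
  toeplitz G ∘L (toeplitz G).adjoint - toeplitz K ∘L (toeplitz K).adjoint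

/-! ### The observability operator -/

theorem IsStable.summable_norm_pow {n : ℕ} {A : Matrix (Fin n) (Fin n) ℂ} (hA : IsStable A) :
    Summable fun k : ℕ => ‖Matrix.toEuclideanCLM (n := Fin n) (𝕜 := ℂ) A ^ k‖ := by
  set a := Matrix.toEuclideanCLM (n := Fin n) (𝕜 := ℂ) A with ha
  have hspec : spectrum ℂ a = spectrum ℂ A := AlgEquiv.spectrum_eq _ A
  rcases subsingleton_or_nontrivial (EuclideanSpace ℂ (Fin n) →L[ℂ] EuclideanSpace ℂ (Fin n))
    with hs | hn
  · have : ∀ k : ℕ, ‖a ^ k‖ = 0 := fun k => by rw [Subsingleton.elim (a ^ k) 0, norm_zero]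
    simp only [this]
    exact summable_zero
  have hr : spectralRadius ℂ a < 1 := by
    refine spectrum.spectralRadius_lt_of_forall_lt a (r := 1) fun k hk => ?_
    rw [hspec] at hk
    exact_mod_cast hA k hk
  obtain ⟨r, hr1, hr2⟩ := ENNReal.lt_iff_exists_nnreal_btwn.1 hr
  have hlim := spectrum.pow_nnnorm_pow_one_div_tendsto_nhds_spectralRadius a
  have hev := (hlim.eventually (gt_mem_nhds hr1)).and (Filter.eventually_gt_atTop 0)
  have hr3 : (r : ℝ) < 1 := by exact_mod_cast hr2
  refine Summable.of_norm_bounded_eventually_nat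
    (summable_geometric_of_lt_one r.coe_nonneg hr3) ?_
  filter_upwards [hev] with k hk
  rw [norm_norm]
  have h1 : ((‖a ^ k‖₊ : ENNReal) ^ (1 / (k : ℝ))) ^ (k : ℝ) ≤ (r : ENNReal) ^ (k : ℝ) :=
    ENNReal.rpow_le_rpow hk.1.le (Nat.cast_nonneg k)
  have hk0 : (k : ℝ) ≠ 0 := by exact_mod_cast hk.2.ne'
  rw [← ENNReal.rpow_mul, one_div_mul_cancel hk0, ENNReal.rpow_one, ENNReal.rpow_natCast] at h1
  exact_mod_cast h1

theorem memℓp_obs {m n : ℕ} (C : Matrix (Fin m) (Fin n) ℂ) {A : Matrix (Fin n) (Fin n) ℂ}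
    (hA : IsStable A) (x : EuclideanSpace ℂ (Fin n)) :
    Memℓp (fun k : ℕ => Matrix.toEuclideanLin (C * A ^ k) x) 2 := by
  refine Memℓp.of_exponent_ge (q := 1) (memℓp_gen ?_) one_le_two
  simp only [ENNReal.toReal_one, Real.rpow_one]
  let L : EuclideanSpace ℂ (Fin n) →L[ℂ] EuclideanSpace ℂ (Fin m) :=
    LinearMap.toContinuousLinearMap (Matrix.toEuclideanLin C)
  refine Summable.of_nonneg_of_le (fun _ => norm_nonneg _) (fun k => ?_)
    ((hA.summable_norm_pow.mul_left ‖L‖).mul_right ‖x‖)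
  have : Matrix.toEuclideanLin (C * A ^ k) x
      = L ((Matrix.toEuclideanCLM (n := Fin n) (𝕜 := ℂ) A ^ k) x) := by
    rw [← map_pow]
    ext i
    simp only [L, LinearMap.coe_toContinuousLinearMap', Matrix.ofLp_toLpLin,
      Matrix.toLin'_apply, Matrix.ofLp_toEuclideanCLM, Matrix.mulVec_mulVec]
  rw [this, mul_assoc]
  exact (L.le_opNorm _).trans (mul_le_mul_of_nonneg_left (ContinuousLinearMap.le_opNorm _ _)
    (norm_nonneg _))

/-- The observability operator `x ↦ (C x, C A x, C A² x, …)`. -/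
def obsOp {m n : ℕ} (C : Matrix (Fin m) (Fin n) ℂ) (A : Matrix (Fin n) (Fin n) ℂ)
    (hA : IsStable A) : EuclideanSpace ℂ (Fin n) →L[ℂ] Seq m :=
  LinearMap.toContinuousLinearMap
    { toFun := fun x => ⟨fun k => Matrix.toEuclideanLin (C * A ^ k) x, memℓp_obs C hA x⟩
      map_add' := fun x y => by
        apply lp.ext
        funext k
        simp only [map_add]
        rfl
      map_smul' := fun c x => by
        apply lp.ext
        funext k
        simp only [map_smul, RingHom.id_apply]
        rfl }

theorem obsOp_apply {m n : ℕ} (C : Matrix (Fin m) (Fin n) ℂ) (A : Matrix (Fin n) (Fin n) ℂ)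
    (hA : IsStable A) (x : EuclideanSpace ℂ (Fin n)) (k : ℕ) :
    obsOp C A hA x k = Matrix.toEuclideanLin (C * A ^ k) x := rfl

/-! ### The Riccati equation -/

/-- `R₀ = D₁ D₁^* - D₂ D₂^* + C (P₁ - P₂) C^*`. -/
def coefR₀ {m n p q : ℕ} (C : Matrix (Fin m) (Fin n) ℂ) (D₁ : Matrix (Fin m) (Fin p) ℂ)
    (D₂ : Matrix (Fin m) (Fin q) ℂ) (P₁ P₂ : Matrix (Fin n) (Fin n) ℂ) :
    Matrix (Fin m) (Fin m) ℂ :=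
  D₁ * D₁ᴴ - D₂ * D₂ᴴ + C * (P₁ - P₂) * Cᴴ

/-- `Γ = B₁ D₁^* - B₂ D₂^* + A (P₁ - P₂) C^*`. -/
def coefΓ {m n p q : ℕ} (A : Matrix (Fin n) (Fin n) ℂ) (B₁ : Matrix (Fin n) (Fin p) ℂ)
    (B₂ : Matrix (Fin n) (Fin q) ℂ) (C : Matrix (Fin m) (Fin n) ℂ)
    (D₁ : Matrix (Fin m) (Fin p) ℂ) (D₂ : Matrix (Fin m) (Fin q) ℂ)
    (P₁ P₂ : Matrix (Fin n) (Fin n) ℂ) : Matrix (Fin n) (Fin m) ℂ :=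
  B₁ * D₁ᴴ - B₂ * D₂ᴴ + A * (P₁ - P₂) * Cᴴ

/-- `Q` is a strictly positive stabilizing solution of the algebraic Riccati equation
`Q = A^* Q A + (C - Γ^* Q A)^* (R₀ - Γ^* Q Γ)⁻¹ (C - Γ^* Q A)`. -/
structure IsStabilizingSolution {m n : ℕ} (A : Matrix (Fin n) (Fin n) ℂ)
    (C : Matrix (Fin m) (Fin n) ℂ) (R₀ : Matrix (Fin m) (Fin m) ℂ)
    (Γ : Matrix (Fin n) (Fin m) ℂ) (Q : Matrix (Fin n) (Fin n) ℂ) : Prop where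
  posDef : Q.PosDef
  posDef_schur : (R₀ - Γᴴ * Q * Γ).PosDef
  riccati : Q = Aᴴ * Q * A +
    (C - Γᴴ * Q * A)ᴴ * (R₀ - Γᴴ * Q * Γ)⁻¹ * (C - Γᴴ * Q * A)
  stable : IsStable (A - Γ * (R₀ - Γᴴ * Q * Γ)⁻¹ * (C - Γᴴ * Q * A))

end

end Leech

open Leech

namespace Leech

noncomputable section

open ContinuousLinearMap Filter Topology

local postfix:max "⋆" => ContinuousLinearMap.adjoint

variable {k l m n p q r : ℕ}

/-! ### Matrices as operators -/

/-! Write `T` for the Toeplitz operator of `R`, `L` for `leechOp G K`, `W` for the observability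
operator, `S` for the forward shift and `Δ = P₁ - P₂`. The link between them is `T = L + W Δ W^*`.
Splitting a sequence into its initial entry and its tail, both sides have the block form `[[R₀, Γ^*
W^*], [W Γ, ·]]` whose last corner is the operator itself (`hasBlockForm_symbolR`,
`hasBlockForm_leech`). Such a block form determines the operator (`HasBlockForm.unique`).

If `L > 0` then `T > 0`: replacing `y` by `S^j y` changes neither `⟨T y, y⟩` nor `‖y‖`, while `W^*
S^j = A^{*j} W^*` tends to zero, so the correction term disappears in the limit
(`HasBlockForm.le_inner`).

If `T > 0`, put `X = T⁻¹ W`, `Q = W^* X`, and let `C₀ x` be the initial entry of `X x`. The two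
block rows of `T X = W` give `S^* X = X (A - Γ C₀)` and `(R₀ - Γ^* Q Γ) C₀ = C - Γ^* Q A`. The
Riccati equation is then the recursion for `W^*`, the Schur complement argument gives (a), and
stability holds because eigenvalues of the backward shift on square summable sequences have modulus
less than one (`HasBlockForm.exists_isStabilizingSolution`).

Conversely, a stabilizing `Q` recovers `X` as the observability operator of `(C₀, A - Γ C₀)`, with
`T X = W` and `W^* X = Q`. Completing the square in the block form leaves a form in the same `T`, so
the step can be iterated; this yields `⟨T y, y⟩ ≥ σ ‖g‖²`, where `y ↦ g` has a bounded left inverse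
(`HasBlockForm.isStrictlyPositive_and_eq`).

Finally `L = T - W Δ W^*` is a finite rank perturbation with `W^* T⁻¹ W = Q`. Its positivity is
governed by `Q⁻¹ - Δ` (`posDef_of_isStrictlyPositive`, `inner_perturbation`), and its inverse is
given by the Woodbury formula (`ringInverse_perturbation`). -/

theorem coefLin_apply (M : Matrix (Fin k) (Fin r) ℂ) (x : EuclideanSpace ℂ (Fin r)) :
    coefLin M x = Matrix.toEuclideanLin M x := rfl

theorem ofLp_coefLin (M : Matrix (Fin k) (Fin r) ℂ) (x : EuclideanSpace ℂ (Fin r)) :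
    (coefLin M x).ofLp = M *ᵥ x.ofLp := rfl

theorem coefLin_mul (M : Matrix (Fin k) (Fin l) ℂ) (N : Matrix (Fin l) (Fin r) ℂ) :
    coefLin (M * N) = coefLin M ∘L coefLin N := by
  ext x i
  simp [ofLp_coefLin, Matrix.mulVec_mulVec]

theorem coefLin_mul_apply (M : Matrix (Fin k) (Fin l) ℂ) (N : Matrix (Fin l) (Fin r) ℂ)
    (x : EuclideanSpace ℂ (Fin r)) : coefLin (M * N) x = coefLin M (coefLin N x) := by
  rw [coefLin_mul, comp_apply]

theorem coefLin_one_apply (x : EuclideanSpace ℂ (Fin r)) :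
    coefLin (1 : Matrix (Fin r) (Fin r) ℂ) x = x := by
  ext i
  simp [ofLp_coefLin]

theorem coefLin_add (M N : Matrix (Fin k) (Fin r) ℂ) :
    coefLin (M + N) = coefLin M + coefLin N := by
  simp [coefLin]

theorem coefLin_sub (M N : Matrix (Fin k) (Fin r) ℂ) :
    coefLin (M - N) = coefLin M - coefLin N := by
  simp [coefLin]

theorem coefLin_add_apply (M N : Matrix (Fin k) (Fin r) ℂ) (x : EuclideanSpace ℂ (Fin r)) :
    coefLin (M + N) x = coefLin M x + coefLin N x := by
  rw [coefLin_add, add_apply]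

theorem coefLin_sub_apply (M N : Matrix (Fin k) (Fin r) ℂ) (x : EuclideanSpace ℂ (Fin r)) :
    coefLin (M - N) x = coefLin M x - coefLin N x := by
  rw [coefLin_sub, sub_apply]

theorem coefLin_zero : coefLin (0 : Matrix (Fin k) (Fin r) ℂ) = 0 := by
  simp [coefLin]

theorem coefLin_adjoint (M : Matrix (Fin k) (Fin r) ℂ) : (coefLin M)⋆ = coefLin Mᴴ := by
  symm
  rw [eq_adjoint_iff]
  intro x y
  simp only [EuclideanSpace.inner_eq_star_dotProduct, ofLp_coefLin, Matrix.star_mulVec,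
    Matrix.conjTranspose_conjTranspose]
  rw [dotProduct_comm, ← Matrix.dotProduct_mulVec, dotProduct_comm]

theorem coefLin_surjective :
    Function.Surjective (coefLin : Matrix (Fin k) (Fin r) ℂ → _) := fun L =>
  ⟨Matrix.toEuclideanLin.symm L, by ext; simp [coefLin]⟩

theorem coefLin_injective : Function.Injective (coefLin : Matrix (Fin k) (Fin r) ℂ → _) :=
  fun _ _ h => Matrix.toEuclideanLin.injective (LinearMap.toContinuousLinearMap.injective h)

theorem inner_coefLin_left (M : Matrix (Fin k) (Fin r) ℂ) (x : EuclideanSpace ℂ (Fin r))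
    (y : EuclideanSpace ℂ (Fin k)) : inner ℂ (coefLin M x) y = inner ℂ x (coefLin Mᴴ y) := by
  rw [← coefLin_adjoint, adjoint_inner_right]

theorem posDef_iff_inner_coefLin {M : Matrix (Fin n) (Fin n) ℂ} : M.PosDef ↔
    M.IsHermitian ∧ ∀ x : EuclideanSpace ℂ (Fin n), x ≠ 0 → 0 < inner ℂ x (coefLin M x) := by
  rw [Matrix.posDef_iff_dotProduct_mulVec]
  refine and_congr_right fun _ => ⟨fun h x hx => ?_, fun h x hx => ?_⟩
  · have := h (x := x.ofLp) (by simpa using hx)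
    rwa [dotProduct_comm] at this
  · have := h (WithLp.toLp 2 x) (by simpa using hx)
    rw [dotProduct_comm]
    exact this

/-! ### Shift operators -/

/-- The backward shift. -/
def bshift (k : ℕ) : Seq k →L[ℂ] Seq k := layer (ContinuousLinearMap.id ℂ _) (-1)

/-- The forward shift. -/
def fshift (k : ℕ) : Seq k →L[ℂ] Seq k := layer (ContinuousLinearMap.id ℂ _) 1

/-- The initial entry of a sequence. -/
def ev0 (k : ℕ) : Seq k →L[ℂ] EuclideanSpace ℂ (Fin k) :=
  lp.evalCLM ℂ (fun _ : ℕ => EuclideanSpace ℂ (Fin k)) 2 0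

theorem bshift_apply (x : Seq k) (i : ℕ) : bshift k x i = x (i + 1) := by
  have h : 0 ≤ (i : ℤ) - -1 := by omega
  have h1 : ((i : ℤ) - -1).toNat = i + 1 := by omega
  simp only [bshift, layer_apply, shiftFun, if_pos h, h1, id_apply]

theorem fshift_zero (x : Seq k) : fshift k x 0 = 0 := by
  simp [fshift, layer_apply, shiftFun]

theorem fshift_succ (x : Seq k) (i : ℕ) : fshift k x (i + 1) = x i := by
  simp [fshift, layer_apply, shiftFun]

theorem ev0_apply (x : Seq k) : ev0 k x = x 0 := rfl

theorem bshift_pow_apply (x : Seq k) (i j : ℕ) : (bshift k ^ j) x i = x (i + j) := by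
  induction j generalizing x i with
  | zero => rfl
  | succ j ih => rw [pow_succ, mul_apply_eq_comp, ih, bshift_apply, add_assoc]

theorem ev0_bshift_pow (x : Seq k) (j : ℕ) : ev0 k ((bshift k ^ j) x) = x j := by
  rw [ev0_apply, bshift_pow_apply, zero_add]

theorem seq_ext {x y : Seq k} (h0 : ev0 k x = ev0 k y) (h1 : bshift k x = bshift k y) : x = y := by
  apply lp.ext
  funext i
  cases i with
  | zero => exact h0
  | succ i => rw [← bshift_apply, ← bshift_apply, h1]

theorem bshift_fshift (x : Seq k) : bshift k (fshift k x) = x := by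
  apply lp.ext
  funext i
  rw [bshift_apply, fshift_succ]

theorem inner_eq_ev0_add_bshift (x y : Seq k) :
    inner ℂ x y = inner ℂ (ev0 k x) (ev0 k y) + inner ℂ (bshift k x) (bshift k y) := by
  have h := lp.hasSum_inner (𝕜 := ℂ) x y
  rw [← hasSum_nat_add_iff' 1, Finset.sum_range_one] at h
  have h1 := lp.hasSum_inner (𝕜 := ℂ) (bshift k x) (bshift k y)
  simp only [bshift_apply] at h1
  rw [h1.unique h, ev0_apply, ev0_apply, add_sub_cancel]

theorem bshift_adjoint : (bshift k)⋆ = fshift k := by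
  symm
  rw [eq_adjoint_iff]
  intro x y
  rw [inner_eq_ev0_add_bshift, bshift_fshift, ev0_apply, fshift_zero, inner_zero_left, zero_add]

theorem ev0_adjoint_apply (v : EuclideanSpace ℂ (Fin k)) :
    (ev0 k)⋆ v = lp.single 2 0 v := by
  refine ext_inner_right ℂ fun y => ?_
  rw [adjoint_inner_left, lp.inner_single_left]
  rfl

theorem bshift_bshift_adjoint (x : Seq k) : bshift k ((bshift k)⋆ x) = x := by
  rw [bshift_adjoint, bshift_fshift]

theorem ev0_bshift_adjoint (x : Seq k) : ev0 k ((bshift k)⋆ x) = 0 := by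
  rw [bshift_adjoint, ev0_apply, fshift_zero]

theorem ev0_ev0_adjoint (v : EuclideanSpace ℂ (Fin k)) : ev0 k ((ev0 k)⋆ v) = v := by
  rw [ev0_adjoint_apply, ev0_apply, lp.single_apply_self]

theorem bshift_ev0_adjoint (v : EuclideanSpace ℂ (Fin k)) : bshift k ((ev0 k)⋆ v) = 0 := by
  apply lp.ext
  funext i
  rw [ev0_adjoint_apply, bshift_apply, lp.single_apply_ne _ _ _ (Nat.succ_ne_zero i)]
  rfl

/-- An operator intertwining the backward shift with `M` is determined by its initial entry. -/
theorem ev0_intertwine {F : Type*} [NormedAddCommGroup F] [NormedSpace ℂ F]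
    {D : F →L[ℂ] Seq k} {M : F →L[ℂ] F} (h : ∀ x, bshift k (D x) = D (M x)) (x : F) (j : ℕ) :
    D x j = ev0 k (D ((M ^ j) x)) := by
  induction j generalizing x with
  | zero => rfl
  | succ j ih => rw [← bshift_apply, h, ih, pow_succ, mul_apply_eq_comp]

/-- The uniqueness tool of the file: it is applied with `M` the backward shift, to compare two
operators of the same block form, and with `M = A - Γ C₀`, to prove `T X = W`. -/
theorem eq_zero_of_intertwine {F : Type*} [NormedAddCommGroup F] [NormedSpace ℂ F]
    {D : F →L[ℂ] Seq k} {M : F →L[ℂ] F} (h : ∀ x, bshift k (D x) = D (M x))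
    (h0 : ∀ x, ev0 k (D x) = 0) : D = 0 := by
  ext1 x
  apply lp.ext
  funext j
  rw [ev0_intertwine h, h0]
  rfl

theorem tendsto_seq_apply (x : Seq k) : Tendsto (fun j => x j) atTop (𝓝 0) := by
  have h := (lp.memℓp x).summable (by norm_num)
  have h1 := h.tendsto_atTop_zero
  rw [tendsto_zero_iff_norm_tendsto_zero]
  have h2 := h1.rpow_const (p := (1 / 2 : ℝ)) (Or.inr (by norm_num))
  have e : ∀ j, (‖x j‖ ^ (2 : ENNReal).toReal) ^ (1 / 2 : ℝ) = ‖x j‖ := fun j => by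
    rw [← Real.rpow_mul (norm_nonneg _)]
    norm_num
  simpa only [e, Real.zero_rpow (by norm_num : (1 / 2 : ℝ) ≠ 0)] using h2

theorem norm_sq_eq_ev0_add_bshift (x : Seq k) :
    ‖x‖ ^ 2 = ‖ev0 k x‖ ^ 2 + ‖bshift k x‖ ^ 2 := by
  have h := inner_eq_ev0_add_bshift x x
  simp only [inner_self_eq_norm_sq_to_K] at h
  exact_mod_cast h

theorem sum_add_norm_bshift_pow (x : Seq k) (j : ℕ) :
    ‖x‖ ^ 2 = ∑ i ∈ Finset.range j, ‖x i‖ ^ 2 + ‖(bshift k ^ j) x‖ ^ 2 := by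
  induction j with
  | zero => simp
  | succ j ih =>
    rw [ih, Finset.sum_range_succ, norm_sq_eq_ev0_add_bshift ((bshift k ^ j) x), ev0_bshift_pow,
      ← mul_apply_eq_comp, ← pow_succ', add_assoc]

theorem hasSum_norm_sq (x : Seq k) : HasSum (fun i => ‖x i‖ ^ 2) (‖x‖ ^ 2) := by
  simpa using lp.hasSum_norm (p := 2) (by norm_num) x

theorem tendsto_bshift_pow (x : Seq k) :
    Tendsto (fun j => (bshift k ^ j) x) atTop (𝓝 0) := by
  rw [tendsto_zero_iff_norm_tendsto_zero]
  have h := (hasSum_norm_sq x).tendsto_sum_nat.const_sub (‖x‖ ^ 2)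
  rw [sub_self] at h
  have h1 := h.sqrt
  rw [Real.sqrt_zero] at h1
  refine h1.congr fun j => ?_
  rw [sum_add_norm_bshift_pow x j, add_sub_cancel_left, Real.sqrt_sq (norm_nonneg _)]

/-! ### Stability -/

theorem coefLin_pow (A : Matrix (Fin n) (Fin n) ℂ) (j : ℕ) : coefLin (A ^ j) = coefLin A ^ j :=
  map_pow (Matrix.toEuclideanCLM (n := Fin n) (𝕜 := ℂ)) A j

theorem IsStable.summable {A : Matrix (Fin n) (Fin n) ℂ} (hA : IsStable A) :
    Summable fun j : ℕ => ‖coefLin A ^ j‖ := hA.summable_norm_pow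

theorem IsStable.tendsto {A : Matrix (Fin n) (Fin n) ℂ} (hA : IsStable A) :
    Tendsto (fun j : ℕ => coefLin A ^ j) atTop (𝓝 0) :=
  tendsto_zero_iff_norm_tendsto_zero.2 hA.summable.tendsto_atTop_zero

theorem isStable_of_eigenvector {A : Matrix (Fin n) (Fin n) ℂ}
    (h : ∀ (μ : ℂ) (v : EuclideanSpace ℂ (Fin n)), v ≠ 0 → coefLin A v = μ • v → ‖μ‖ < 1) :
    IsStable A := by
  intro μ hμ
  rw [← Matrix.spectrum_toLpLin 2, ← Module.End.hasEigenvalue_iff_mem_spectrum] at hμ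
  obtain ⟨v, hv⟩ := hμ.exists_hasEigenvector
  exact h μ v hv.2 hv.apply_eq_smul

theorem IsStable.isUnit {A : Matrix (Fin n) (Fin n) ℂ} (hA : IsStable A) {z : ℂ} (hz : ‖z‖ ≤ 1) :
    IsUnit (1 - z • A) := by
  rcases eq_or_ne z 0 with rfl | h0
  · simp
  have h1 : z⁻¹ ∉ spectrum ℂ A := fun h => by
    have := hA _ h
    rw [norm_inv] at this
    exact absurd this (not_lt.2 (one_le_inv₀ (norm_pos_iff.2 h0) |>.2 hz))
  rw [spectrum.notMem_iff] at h1
  have h2 : (1 - z • A) = z • (algebraMap ℂ (Matrix (Fin n) (Fin n) ℂ) z⁻¹ - A) := by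
    rw [smul_sub, Algebra.algebraMap_eq_smul_one, smul_smul, mul_inv_cancel₀ h0, one_smul]
  rw [h2]
  exact IsUnit.smul (Units.mk0 z h0) h1

/-- Iterating the equation gives `Z = A ^ j * Z * B ^ j`, and the powers of both stable matrices
tend to zero. -/
theorem IsStable.eq_zero_of_stein {A : Matrix (Fin k) (Fin k) ℂ} {B : Matrix (Fin n) (Fin n) ℂ}
    (hA : IsStable A) (hB : IsStable B) {Z : Matrix (Fin k) (Fin n) ℂ} (h : Z = A * Z * B) :
    Z = 0 := by
  have h1 : ∀ j : ℕ, Z = A ^ j * Z * B ^ j := fun j => by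
    induction j with
    | zero => simp
    | succ j ih =>
      conv_lhs => rw [ih, h]
      rw [pow_succ, pow_succ']
      simp only [Matrix.mul_assoc]
  have h2 : Tendsto (fun j : ℕ => ‖coefLin A ^ j‖ * ‖coefLin Z‖ * ‖coefLin B ^ j‖) atTop
      (𝓝 (0 * ‖coefLin Z‖ * 0)) :=
    (hA.summable.tendsto_atTop_zero.mul_const _).mul hB.summable.tendsto_atTop_zero
  rw [mul_zero] at h2
  have h3 : ‖coefLin Z‖ ≤ 0 := ge_of_tendsto' h2 fun j => by
    conv_lhs => rw [h1 j]
    rw [coefLin_mul, coefLin_mul, coefLin_pow, coefLin_pow]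
    exact (opNorm_comp_le _ _).trans
      (mul_le_mul_of_nonneg_right (opNorm_comp_le _ _) (norm_nonneg _))
  apply coefLin_injective
  rw [norm_le_zero_iff.1 h3, coefLin_zero]

theorem IsStable.conjTranspose {A : Matrix (Fin n) (Fin n) ℂ} (hA : IsStable A) :
    IsStable Aᴴ := by
  intro μ hμ
  rw [← Matrix.star_eq_conjTranspose, spectrum.map_star, Set.mem_star] at hμ
  simpa using hA _ hμ

/-! ### The observability operator -/

section Obs

variable {C : Matrix (Fin m) (Fin n) ℂ} {A : Matrix (Fin n) (Fin n) ℂ} {hA : IsStable A}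

theorem ev0_obsOp (x : EuclideanSpace ℂ (Fin n)) : ev0 m (obsOp C A hA x) = coefLin C x := by
  rw [ev0_apply, obsOp_apply, pow_zero, Matrix.mul_one, coefLin_apply]

theorem bshift_obsOp (x : EuclideanSpace ℂ (Fin n)) :
    bshift m (obsOp C A hA x) = obsOp C A hA (coefLin A x) := by
  apply lp.ext
  funext i
  rw [bshift_apply, obsOp_apply, obsOp_apply, ← coefLin_apply, ← coefLin_apply,
    ← coefLin_mul_apply, Matrix.mul_assoc, ← pow_succ]

/-- `W` is the block column with initial entry `C` and tail `W A`; this is the corresponding block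
row for `W^*`. It is the source of every Stein-type equation below. -/
theorem obsOp_adjoint_apply (y : Seq m) :
    (obsOp C A hA)⋆ y = coefLin Cᴴ (ev0 m y) + coefLin Aᴴ ((obsOp C A hA)⋆ (bshift m y)) := by
  refine ext_inner_left ℂ fun x => ?_
  rw [adjoint_inner_right, inner_eq_ev0_add_bshift, ev0_obsOp, bshift_obsOp, inner_add_right,
    inner_coefLin_left, ← adjoint_inner_right (obsOp C A hA), inner_coefLin_left]

theorem hasSum_obsOp_adjoint (y : Seq m) :
    HasSum (fun j => coefLin (C * A ^ j)ᴴ (y j)) ((obsOp C A hA)⋆ y) := by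
  have h := (lp.hasSum_single (p := 2) (by norm_num) y).mapL ((obsOp C A hA)⋆)
  refine h.congr_fun fun j => ?_
  refine ext_inner_left ℂ fun x => ?_
  rw [adjoint_inner_right, lp.inner_single_right, obsOp_apply, ← coefLin_apply,
    inner_coefLin_left]

end Obs

/-! ### State trajectories -/

theorem hasSum_seq_apply {ι : Type*} {f : ι → (Seq r →L[ℂ] Seq k)} {T : Seq r →L[ℂ] Seq k}
    (h : HasSum f T) (x : Seq r) (i : ℕ) : HasSum (fun l => f l x i) (T x i) := by
  have h1 : HasSum (fun l => f l x) (T x) := (ContinuousLinearMap.apply ℂ (Seq k) x).hasSum h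
  exact (lp.evalCLM ℂ (fun _ : ℕ => EuclideanSpace ℂ (Fin k)) 2 i).hasSum h1

/-- The state trajectory of the system `(A, Γ)` started at zero and driven by `y`. It is bounded
because it is the norm convergent sum over `l` of the block diagonals `A ^ l * Γ` delayed by `l +
1`. -/
theorem exists_stateOp {A : Matrix (Fin n) (Fin n) ℂ} (hA : IsStable A)
    (Γ : Matrix (Fin n) (Fin m) ℂ) : ∃ V : Seq m →L[ℂ] Seq n,
      ∀ y, V y 0 = 0 ∧ ∀ j, V y (j + 1) = coefLin A (V y j) + coefLin Γ (y j) := by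
  have hf : Summable fun l : ℕ => layer (coefLin (A ^ l * Γ)) ((l : ℤ) + 1) := by
    refine Summable.of_norm_bounded (hA.summable.mul_right ‖coefLin Γ‖) fun l => ?_
    refine (norm_layer_le _ _).trans ?_
    rw [coefLin_mul, coefLin_pow]
    exact opNorm_comp_le _ _
  obtain ⟨V, hV⟩ := hf
  have happ : ∀ (y : Seq m) (i : ℕ),
      HasSum (fun l : ℕ => coefLin (A ^ l * Γ) (shiftFun ((l : ℤ) + 1) y i)) (V y i) :=
    fun y i => by simpa only [layer_apply] using hasSum_seq_apply hV y i
  refine ⟨V, fun y => ⟨?_, fun j => ?_⟩⟩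
  · refine (happ y 0).unique ?_
    have h : ∀ l : ℕ, ¬ (0 ≤ ((0 : ℕ) : ℤ) - ((l : ℤ) + 1)) := fun l => by omega
    simp only [shiftFun, if_neg (h _), map_zero]
    exact hasSum_zero
  -- The term `l = 0` at time `j + 1` is `Γ y_j`; the terms `l + 1` are `A` applied to the terms `l`
  -- at time `j`.
  · have h1 := (coefLin A).hasSum (happ y j)
    have h2 := (happ y (j + 1))
    rw [← hasSum_nat_add_iff' 1] at h2
    have hs : ∀ l : ℕ, coefLin (A ^ (l + 1) * Γ) (shiftFun (((l + 1 : ℕ) : ℤ) + 1) y (j + 1))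
        = coefLin A (coefLin (A ^ l * Γ) (shiftFun ((l : ℤ) + 1) y j)) := fun l => by
      have h : ((j + 1 : ℕ) : ℤ) - (((l + 1 : ℕ) : ℤ) + 1) = (j : ℤ) - ((l : ℤ) + 1) := by
        push_cast; ring
      simp only [shiftFun, h]
      rw [← coefLin_mul_apply, ← Matrix.mul_assoc, ← pow_succ']
    have h0 : shiftFun (((0 : ℕ) : ℤ) + 1) y (j + 1) = y j := by simp [shiftFun]
    simp only [hs, Finset.sum_range_one, h0, pow_zero, Matrix.one_mul] at h2
    rw [← h2.unique h1, sub_add_cancel]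

/-! ### Fourier coefficients -/

theorem circleAverage_zpow (l : ℤ) :
    Real.circleAverage (fun z : ℂ => z ^ l) 0 1 = if l = 0 then 1 else 0 := by
  split_ifs with h
  · subst h
    simpa using Real.circleAverage_const (1 : ℂ) (0 : ℂ) 1
  · rw [Real.circleAverage_eq_circleIntegral one_ne_zero]
    have h1 := circleIntegral.integral_sub_zpow_of_ne (n := l - 1) (by omega) 0 0 1
    have h2 : (∮ z in C(0, 1), (z - 0)⁻¹ • z ^ l) = ∮ z in C(0, 1), (z - 0) ^ (l - 1) := by
      refine circleIntegral.integral_congr zero_le_one fun z hz => ?_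
      have hz0 : z ≠ 0 := by
        rintro rfl
        simp at hz
      simp only [sub_zero, smul_eq_mul]
      rw [zpow_sub_one₀ hz0, mul_comm]
    rw [h2, h1, smul_zero]

/-- Termwise integration of an absolutely convergent Laurent series, dominated by `‖M k‖`, with
orthogonality of the powers of `z` on the circle. -/
theorem circleAverage_of_hasSum {M : ℤ → ℂ} (hM : Summable fun k => ‖M k‖) {f : ℂ → ℂ}
    (hf : ∀ z : ℂ, ‖z‖ = 1 → HasSum (fun k : ℤ => z ^ k * M k) (f z)) (l : ℤ) :
    Real.circleAverage (fun z => z ^ (-l) * f z) 0 1 = M l := by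
  have hz : ∀ θ : ℝ, ‖circleMap 0 1 θ‖ = 1 := fun θ => by simp
  have hz0 : ∀ θ : ℝ, circleMap 0 1 θ ≠ 0 := fun θ => circleMap_ne_center one_ne_zero
  have h1 : HasSum (fun k : ℤ => ∫ θ in (0 : ℝ)..2 * Real.pi,
      circleMap 0 1 θ ^ (-l) * (circleMap 0 1 θ ^ k * M k))
      (∫ θ in (0 : ℝ)..2 * Real.pi, circleMap 0 1 θ ^ (-l) * f (circleMap 0 1 θ)) := by
    refine intervalIntegral.hasSum_integral_of_dominated_convergence (fun k _ => ‖M k‖)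
      (fun k => ?_) (fun k => ?_) ?_ ?_ ?_
    · have hc : Continuous fun θ : ℝ => circleMap 0 1 θ ^ (-l) * (circleMap 0 1 θ ^ k * M k) := by
        have h : ∀ j : ℤ, Continuous fun θ : ℝ => circleMap 0 1 θ ^ j := fun j =>
          (continuous_circleMap 0 1).zpow₀ j fun θ => Or.inl (hz0 θ)
        exact (h _).mul ((h _).mul continuous_const)
      exact hc.aestronglyMeasurable
    · refine Filter.Eventually.of_forall fun θ _ => ?_
      rw [norm_mul, norm_mul, norm_zpow, norm_zpow, hz, one_zpow, one_zpow, one_mul, one_mul]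
    · exact Filter.Eventually.of_forall fun θ _ => hM
    · exact intervalIntegrable_const
    · exact Filter.Eventually.of_forall fun θ _ => (hf _ (hz θ)).mul_left _
  have h2 : ∀ k : ℤ, (∫ θ in (0 : ℝ)..2 * Real.pi,
      circleMap 0 1 θ ^ (-l) * (circleMap 0 1 θ ^ k * M k))
      = (2 * Real.pi) * if k = l then M l else 0 := fun k => by
    have h3 := circleAverage_zpow (k - l)
    rw [Real.circleAverage_def] at h3
    have h4 : (∫ θ in (0 : ℝ)..2 * Real.pi,
        circleMap 0 1 θ ^ (-l) * (circleMap 0 1 θ ^ k * M k))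
        = (∫ θ in (0 : ℝ)..2 * Real.pi, circleMap 0 1 θ ^ (k - l)) * M k := by
      rw [← intervalIntegral.integral_mul_const]
      congr 1
      funext θ
      rw [← mul_assoc, ← zpow_add₀ (hz0 θ), neg_add_eq_sub]
    have h5 : (∫ θ in (0 : ℝ)..2 * Real.pi, circleMap 0 1 θ ^ (k - l))
        = (2 * Real.pi) * if k - l = 0 then 1 else 0 := by
      rw [← h3, Complex.real_smul]
      push_cast
      rw [mul_inv_cancel_left₀]
      exact_mod_cast Real.two_pi_pos.ne'
    rw [h4, h5]
    rcases eq_or_ne k l with rfl | h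
    · simp
    · simp [h, sub_eq_zero]
  simp only [h2] at h1
  have h6 := h1.unique ((hasSum_ite_eq l (M l)).mul_left (2 * Real.pi : ℂ))
  rw [Real.circleAverage_def, h6, Complex.real_smul]
  push_cast
  rw [inv_mul_cancel_left₀]
  exact mul_ne_zero two_ne_zero (Complex.ofReal_ne_zero.2 Real.pi_ne_zero)

theorem hasSum_resolvent {A : Matrix (Fin n) (Fin n) ℂ} (hA : IsStable A) {z : ℂ}
    (hz : ‖z‖ ≤ 1) : HasSum (fun k : ℕ => z ^ k • A ^ k) (1 - z • A)⁻¹ := by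
  set a := coefLin (z • A) with ha
  have hpow : ∀ k : ℕ, a ^ k = coefLin (z ^ k • A ^ k) := fun k => by
    rw [ha, ← coefLin_pow, smul_pow]
  have hs : Summable fun k : ℕ => a ^ k := by
    refine Summable.of_norm_bounded hA.summable fun k => ?_
    rw [hpow, ← coefLin_pow]
    have : coefLin (z ^ k • A ^ k) = z ^ k • coefLin (A ^ k) := by simp [coefLin]
    rw [this, norm_smul, norm_pow]
    exact mul_le_of_le_one_left (norm_nonneg _) (pow_le_one₀ (norm_nonneg _) hz)
  -- The Neumann series is summed in the algebra of operators and carried back to matrices by `e`,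
  -- which is continuous by finite dimensionality.
  let e := (Matrix.toEuclideanCLM (n := Fin n) (𝕜 := ℂ)).symm
  have he : Continuous e :=
    LinearMap.continuous_of_finiteDimensional e.toAlgEquiv.toLinearMap
  have h1 := hs.hasSum.map e he
  have h2 : e (∑' k, a ^ k) * (1 - z • A) = 1 := by
    have h3 := congrArg e hs.tsum_pow_mul_one_sub
    rw [map_mul, map_sub, map_one] at h3
    have h4 : e a = z • A := (Matrix.toEuclideanCLM (n := Fin n) (𝕜 := ℂ)).symm_apply_apply _
    rwa [h4] at h3
  rw [← Matrix.inv_eq_left_inv h2] at h1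
  refine h1.congr_fun fun k => ?_
  rw [Function.comp_apply, hpow]
  exact ((Matrix.toEuclideanCLM (n := Fin n) (𝕜 := ℂ)).symm_apply_apply _).symm

theorem hasSum_transfer {A : Matrix (Fin n) (Fin n) ℂ} (hA : IsStable A) {z : ℂ}
    (hz : ‖z‖ ≤ 1) (C : Matrix (Fin k) (Fin n) ℂ) (B : Matrix (Fin n) (Fin r) ℂ) (i : Fin k)
    (j : Fin r) :
    HasSum (fun s : ℕ => z ^ (s + 1) * (C * A ^ s * B) i j)
      ((z • (C * (1 - z • A)⁻¹ * B)) i j) := by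
  have hc : Continuous fun X : Matrix (Fin n) (Fin n) ℂ => (C * X * B) i j :=
    ((continuous_const.matrix_mul continuous_id).matrix_mul continuous_const).matrix_elem i j
  let f : Matrix (Fin n) (Fin n) ℂ →+ ℂ :=
    { toFun := fun X => (C * X * B) i j
      map_zero' := by simp
      map_add' := fun X Y => by simp [Matrix.mul_add, Matrix.add_mul] }
  have h := ((hasSum_resolvent hA hz).map f hc).mul_left z
  refine h.congr_fun fun s => ?_
  change _ = z * (C * (z ^ s • A ^ s) * B) i j
  rw [Matrix.mul_smul, Matrix.smul_mul, Matrix.smul_apply, smul_eq_mul, pow_succ']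
  ring

theorem norm_entry_le (M : Matrix (Fin k) (Fin r) ℂ) (i : Fin k) (j : Fin r) :
    ‖M i j‖ ≤ ‖coefLin M‖ := by
  have h1 : M i j = coefLin M (EuclideanSpace.single j 1) i := by
    simp [ofLp_coefLin]
  rw [h1]
  refine (PiLp.norm_apply_le _ i).trans ((le_opNorm _ _).trans ?_)
  simp

theorem summable_markov {A : Matrix (Fin n) (Fin n) ℂ} (hA : IsStable A)
    (C : Matrix (Fin k) (Fin n) ℂ) (B : Matrix (Fin n) (Fin r) ℂ) (i : Fin k) (j : Fin r) :
    Summable fun s : ℕ => ‖(C * A ^ s * B) i j‖ := by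
  refine Summable.of_nonneg_of_le (fun _ => norm_nonneg _) (fun s => ?_)
    ((hA.summable.mul_left ‖coefLin C‖).mul_right ‖coefLin B‖)
  refine (norm_entry_le _ i j).trans ?_
  rw [coefLin_mul, coefLin_mul, coefLin_pow]
  exact (opNorm_comp_le _ _).trans
    (mul_le_mul_of_nonneg_right (opNorm_comp_le _ _) (norm_nonneg _))

/-- The Fourier coefficients of `D + z C (I - z A)⁻¹ B + (z C' (I - z A)⁻¹ B')^*`. -/
def realCoef (A : Matrix (Fin n) (Fin n) ℂ) (B : Matrix (Fin n) (Fin r) ℂ)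
    (C : Matrix (Fin k) (Fin n) ℂ) (D : Matrix (Fin k) (Fin r) ℂ) (B' : Matrix (Fin n) (Fin k) ℂ)
    (C' : Matrix (Fin r) (Fin n) ℂ) : ℤ → Matrix (Fin k) (Fin r) ℂ
  | Int.ofNat 0 => D
  | Int.ofNat (s + 1) => C * A ^ s * B
  | Int.negSucc s => (C' * A ^ s * B')ᴴ

/-- One statement serves all symbols: `B' = 0`, `C' = 0` for `G` and `K`, and `B = B' = Γ`, `C' = C`
for `R`. -/
theorem fourierCoef_eq_realCoef {A : Matrix (Fin n) (Fin n) ℂ} (hA : IsStable A)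
    {B : Matrix (Fin n) (Fin r) ℂ} {C : Matrix (Fin k) (Fin n) ℂ} {D : Matrix (Fin k) (Fin r) ℂ}
    {B' : Matrix (Fin n) (Fin k) ℂ} {C' : Matrix (Fin r) (Fin n) ℂ}
    {F : ℂ → Matrix (Fin k) (Fin r) ℂ}
    (hF : ∀ z : ℂ, ‖z‖ = 1 → F z = D + z • (C * (1 - z • A)⁻¹ * B) +
      (z • (C' * (1 - z • A)⁻¹ * B'))ᴴ) (l : ℤ) :
    fourierCoef F l = realCoef A B C D B' C' l := by
  ext i j
  have h : fourierCoef F l i j = Real.circleAverage (fun z => z ^ (-l) * F z i j) 0 1 := rfl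
  rw [h]
  refine circleAverage_of_hasSum (M := fun l => realCoef A B C D B' C' l i j) ?_ (fun z hz => ?_) l
  · refine Summable.of_nat_of_neg_add_one ?_ ?_
    · refine (summable_nat_add_iff 1).1 ?_
      exact summable_markov hA C B i j
    · have h : ∀ s : ℕ, (-((s : ℤ) + 1)) = Int.negSucc s := fun s => (Int.negSucc_eq s).symm
      simp only [h, realCoef, Matrix.conjTranspose_apply, norm_star]
      exact summable_markov hA C' B' j i
  · have h0 : z ≠ 0 := fun h => by simp [h] at hz
    rw [hF z hz, Matrix.add_apply, Matrix.conjTranspose_apply]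
    refine HasSum.of_nat_of_neg_add_one ?_ ?_
    · rw [← hasSum_nat_add_iff' 1]
      have e : (D + z • (C * (1 - z • A)⁻¹ * B)) i j - ∑ s ∈ Finset.range 1,
          z ^ (s : ℤ) * realCoef A B C D B' C' s i j = (z • (C * (1 - z • A)⁻¹ * B)) i j := by
        rw [Finset.sum_range_one, Nat.cast_zero, zpow_zero, one_mul, Matrix.add_apply]
        exact add_sub_cancel_left _ _
      rw [e]
      refine (hasSum_transfer hA hz.le C B i j).congr_fun fun s => ?_
      rw [zpow_natCast]
      rfl
    · have h1 := (hasSum_transfer hA hz.le C' B' j i).star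
      refine h1.congr_fun fun s => ?_
      have h : (-((s : ℤ) + 1)) = Int.negSucc s := (Int.negSucc_eq s).symm
      rw [star_mul', h]
      -- On the unit circle conjugation is inversion, so the adjoint of the power series supplies
      -- the negative powers.
      have hz1 : star z = z⁻¹ := by
        rw [Complex.inv_def, Complex.normSq_eq_norm_sq, hz]
        simp
      rw [star_pow, hz1, zpow_negSucc, inv_pow]
      rfl

/-! ### Block structure of Toeplitz operators -/

section Structure

variable {A : Matrix (Fin n) (Fin n) ℂ} (hA : IsStable A)
    {B : Matrix (Fin n) (Fin r) ℂ} {C : Matrix (Fin k) (Fin n) ℂ} {D : Matrix (Fin k) (Fin r) ℂ}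
    {B' : Matrix (Fin n) (Fin k) ℂ} {C' : Matrix (Fin r) (Fin n) ℂ}
    {F : ℂ → Matrix (Fin k) (Fin r) ℂ} {T : Seq r →L[ℂ] Seq k}

/-- Deleting the first block row leaves the first column `(C A^i B)_i`, which is `W B`, followed by
the same Toeplitz matrix. -/
theorem IsToeplitz.bshift_apply (hT : IsToeplitz F T)
    (hF : ∀ l, fourierCoef F l = realCoef A B C D B' C' l) (y : Seq r) :
    bshift k (T y) = obsOp C A hA (coefLin B (ev0 r y)) + T (bshift r y) := by
  apply lp.ext
  funext i
  have h1 := hT y (i + 1)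
  rw [← hasSum_nat_add_iff' 1, Finset.sum_range_one] at h1
  have h2 := hT (bshift r y) i
  have h3 : ∀ j : ℕ, ((i + 1 : ℕ) : ℤ) - ((j + 1 : ℕ) : ℤ) = (i : ℤ) - (j : ℤ) := fun j => by
    push_cast; ring
  simp only [h3] at h1
  simp only [Leech.bshift_apply] at h2
  have h4 := h1.unique h2
  have h5 : fourierCoef F (((i + 1 : ℕ) : ℤ) - ((0 : ℕ) : ℤ)) = C * A ^ i * B := by
    rw [hF, Nat.cast_zero, sub_zero]
    rfl
  rw [h5, sub_eq_iff_eq_add'] at h4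
  rw [Leech.bshift_apply, h4, lp.coeFn_add, Pi.add_apply, obsOp_apply, ev0_apply, ← coefLin_apply,
    ← coefLin_apply, coefLin_mul_apply]

theorem IsToeplitz.ev0_apply (hT : IsToeplitz F T)
    (hF : ∀ l, fourierCoef F l = realCoef A B C D B' C' l) (y : Seq r) :
    ev0 k (T y) = coefLin D (ev0 r y) + coefLin B'ᴴ ((obsOp C' A hA)⋆ (bshift r y)) := by
  have h1 := hT y 0
  rw [← hasSum_nat_add_iff' 1, Finset.sum_range_one] at h1
  have h2 := (coefLin B'ᴴ).hasSum (hasSum_obsOp_adjoint (C := C') (hA := hA) (bshift r y))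
  have h3 : ∀ j : ℕ, Matrix.toEuclideanLin (fourierCoef F (((0 : ℕ) : ℤ) - ((j + 1 : ℕ) : ℤ)))
      (y (j + 1)) = coefLin B'ᴴ (coefLin (C' * A ^ j)ᴴ (bshift r y j)) := fun j => by
    have h4 : ((0 : ℕ) : ℤ) - ((j + 1 : ℕ) : ℤ) = Int.negSucc j := by
      rw [Int.negSucc_eq]; push_cast; ring
    rw [h4, hF, ← coefLin_mul_apply, ← Matrix.conjTranspose_mul, Leech.bshift_apply]
    rfl
  simp only [h3] at h1
  have h5 := h1.unique h2
  rw [sub_eq_iff_eq_add'] at h5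
  have h6 : fourierCoef F (((0 : ℕ) : ℤ) - ((0 : ℕ) : ℤ)) = D := by
    rw [hF]
    simp [realCoef]
  rw [Leech.ev0_apply, h5, h6]
  rfl

end Structure

/-! ### The symbol `R` -/

/-- With `N = (1 - zA)⁻¹` one has `z N A = N - 1`. For `|z| = 1` the Stein equation then turns the
product term `N B B^* N^*` into the sum `P + (N - 1) P + P (N^* - 1)`, which separates analytic and
coanalytic parts. -/
theorem symbolR_eq {A P : Matrix (Fin n) (Fin n) ℂ} (hA : IsStable A) (hP : P.IsHermitian)
    {B : Matrix (Fin n) (Fin r) ℂ} (C : Matrix (Fin m) (Fin n) ℂ) (D : Matrix (Fin m) (Fin r) ℂ)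
    (hPB : P - A * P * Aᴴ = B * Bᴴ) {z : ℂ} (hz : ‖z‖ = 1) :
    (D + z • (C * (1 - z • A)⁻¹ * B)) * (D + z • (C * (1 - z • A)⁻¹ * B))ᴴ =
      D * Dᴴ + C * P * Cᴴ + z • (C * (1 - z • A)⁻¹ * (B * Dᴴ + A * P * Cᴴ)) +
      (z • (C * (1 - z • A)⁻¹ * (B * Dᴴ + A * P * Cᴴ)))ᴴ := by
  have hu := (Matrix.isUnit_iff_isUnit_det _).1 (hA.isUnit hz.le)
  set N := (1 - z • A)⁻¹ with hN
  have h1 : (1 - z • A) * N = 1 := Matrix.mul_nonsing_inv _ hu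
  have h1' : N * (1 - z • A) = 1 := Matrix.nonsing_inv_mul _ hu
  have hzz : z * star z = 1 := by
    rw [← starRingEnd_apply, Complex.mul_conj, Complex.normSq_eq_norm_sq, hz]
    simp
  have h2 : z • (N * A) = N - 1 := by
    rw [← h1', Matrix.mul_sub, Matrix.mul_one, Matrix.mul_smul, sub_sub_cancel]
  have h3 : star z • (Aᴴ * Nᴴ) = Nᴴ - 1 := by
    rw [← Matrix.conjTranspose_mul, ← Matrix.conjTranspose_smul, h2, Matrix.conjTranspose_sub,
      Matrix.conjTranspose_one]
  have h4 : N * (B * Bᴴ) * Nᴴ = P + (N - 1) * P + P * (Nᴴ - 1) := by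
    have h5 : N * (A * P * Aᴴ) * Nᴴ = (N - 1) * P * (Nᴴ - 1) := by
      rw [← h2, ← h3]
      simp only [Matrix.smul_mul, Matrix.mul_smul, smul_smul, Matrix.mul_assoc]
      rw [mul_comm, hzz, one_smul]
    rw [← hPB, Matrix.mul_sub, Matrix.sub_mul, h5]
    noncomm_ring
  have h6 : z • (C * N * (A * P * Cᴴ)) = C * ((N - 1) * P) * Cᴴ := by
    rw [← h2]
    simp only [Matrix.smul_mul, Matrix.mul_smul, Matrix.mul_assoc]
  have h7 : (C * N * B) * (C * N * B)ᴴ = C * (N * (B * Bᴴ) * Nᴴ) * Cᴴ := by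
    simp only [Matrix.conjTranspose_mul, Matrix.mul_assoc]
  have h8 : (z • (C * N * B)) * (z • (C * N * B))ᴴ = (C * N * B) * (C * N * B)ᴴ := by
    rw [Matrix.conjTranspose_smul, Matrix.smul_mul, Matrix.mul_smul, smul_smul, hzz, one_smul]
  have h9 : (C * ((N - 1) * P) * Cᴴ)ᴴ = C * (P * (Nᴴ - 1)) * Cᴴ := by
    simp only [Matrix.conjTranspose_mul, Matrix.conjTranspose_conjTranspose,
      Matrix.conjTranspose_sub, Matrix.conjTranspose_one, hP.eq, Matrix.mul_assoc]
  rw [Matrix.mul_add (C * N), smul_add, h6, Matrix.conjTranspose_add, Matrix.conjTranspose_add, h9,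
    Matrix.add_mul, Matrix.mul_add, Matrix.mul_add, h8, h7, h4]
  have h10 : (z • (C * N * (B * Dᴴ)))ᴴ = D * (z • (C * N * B))ᴴ := by
    rw [← Matrix.mul_assoc, ← Matrix.smul_mul, Matrix.conjTranspose_mul,
      Matrix.conjTranspose_conjTranspose]
  have h11 : z • (C * N * (B * Dᴴ)) = z • (C * N * B) * Dᴴ := by
    simp only [Matrix.smul_mul, Matrix.mul_assoc]
  rw [h10, h11]
  simp only [Matrix.mul_add, Matrix.add_mul]
  abel

/-! ### Operators with the block form of the Toeplitz operator of `R` -/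

/-- `T = [[R₀, Γ^* W^*], [W Γ, T]]` with respect to the splitting into initial entry and tail. -/
structure HasBlockForm {A : Matrix (Fin n) (Fin n) ℂ} (hA : IsStable A)
    (C : Matrix (Fin m) (Fin n) ℂ) (R₀ : Matrix (Fin m) (Fin m) ℂ)
    (Γ : Matrix (Fin n) (Fin m) ℂ) (T : Seq m →L[ℂ] Seq m) : Prop where
  ev0_apply : ∀ y, ev0 m (T y) =
    coefLin R₀ (ev0 m y) + coefLin Γᴴ ((obsOp C A hA)⋆ (bshift m y))
  bshift_apply : ∀ y, bshift m (T y) = obsOp C A hA (coefLin Γ (ev0 m y)) + T (bshift m y)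

section Block

variable {A : Matrix (Fin n) (Fin n) ℂ} {hA : IsStable A} {C : Matrix (Fin m) (Fin n) ℂ}
  {R₀ : Matrix (Fin m) (Fin m) ℂ} {Γ : Matrix (Fin n) (Fin m) ℂ} {T T' : Seq m →L[ℂ] Seq m}

/-- The difference of two such operators commutes with the backward shift and has vanishing initial
entry. -/
theorem HasBlockForm.unique (h : HasBlockForm hA C R₀ Γ T) (h' : HasBlockForm hA C R₀ Γ T') :
    T = T' := by
  rw [← sub_eq_zero]
  refine eq_zero_of_intertwine (M := bshift m) (fun x => ?_) fun x => ?_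
  · rw [sub_apply, map_sub, h.bshift_apply, h'.bshift_apply, add_sub_add_left_eq_sub, sub_apply]
  · rw [sub_apply, map_sub, h.ev0_apply, h'.ev0_apply, sub_self]

/-- Here `S = [[D, 0], [W B, S]]`, and the conclusion reads off the blocks of its adjoint `[[D^*,
B^* W^*], [0, S^*]]`. -/
theorem adjoint_of_lowerTriangular {B : Matrix (Fin n) (Fin r) ℂ} {D : Matrix (Fin m) (Fin r) ℂ}
    {S : Seq r →L[ℂ] Seq m} (h0 : ∀ y, ev0 m (S y) = coefLin D (ev0 r y))
    (h1 : ∀ y, bshift m (S y) = obsOp C A hA (coefLin B (ev0 r y)) + S (bshift r y)) (y : Seq m) :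
    ev0 r (S⋆ y) = coefLin Dᴴ (ev0 m y) + coefLin Bᴴ ((obsOp C A hA)⋆ (bshift m y)) ∧
      bshift r (S⋆ y) = S⋆ (bshift m y) := by
  have h : S⋆ y = (ev0 r)⋆ (coefLin Dᴴ (ev0 m y) + coefLin Bᴴ ((obsOp C A hA)⋆ (bshift m y))) +
      (bshift r)⋆ (S⋆ (bshift m y)) := by
    refine ext_inner_left ℂ fun x => ?_
    rw [adjoint_inner_right, inner_eq_ev0_add_bshift, h0, h1]
    simp only [inner_add_right, inner_add_left, adjoint_inner_right, inner_coefLin_left, map_add]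
    rw [← inner_coefLin_left B, adjoint_inner_right]
    ring
  rw [h]
  constructor
  · rw [map_add, ev0_ev0_adjoint, ev0_bshift_adjoint, add_zero]
  · rw [map_add, bshift_ev0_adjoint, bshift_bshift_adjoint, zero_add]

theorem hasBlockForm_leech {B₁ : Matrix (Fin n) (Fin p) ℂ} {B₂ : Matrix (Fin n) (Fin q) ℂ}
    {D₁ : Matrix (Fin m) (Fin p) ℂ} {D₂ : Matrix (Fin m) (Fin q) ℂ}
    {S₁ : Seq p →L[ℂ] Seq m} {S₂ : Seq q →L[ℂ] Seq m}
    (h0 : ∀ y, ev0 m (S₁ y) = coefLin D₁ (ev0 p y))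
    (h1 : ∀ y, bshift m (S₁ y) = obsOp C A hA (coefLin B₁ (ev0 p y)) + S₁ (bshift p y))
    (h0' : ∀ y, ev0 m (S₂ y) = coefLin D₂ (ev0 q y))
    (h1' : ∀ y, bshift m (S₂ y) = obsOp C A hA (coefLin B₂ (ev0 q y)) + S₂ (bshift q y))
    {P₁ P₂ : Matrix (Fin n) (Fin n) ℂ} (hP₁ : P₁ - A * P₁ * Aᴴ = B₁ * B₁ᴴ)
    (hP₂ : P₂ - A * P₂ * Aᴴ = B₂ * B₂ᴴ) (hP₁' : P₁.IsHermitian) (hP₂' : P₂.IsHermitian) :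
    HasBlockForm hA C (coefR₀ C D₁ D₂ P₁ P₂) (coefΓ A B₁ B₂ C D₁ D₂ P₁ P₂)
      (S₁ ∘L S₁⋆ - S₂ ∘L S₂⋆ + obsOp C A hA ∘L coefLin (P₁ - P₂) ∘L (obsOp C A hA)⋆) := by
  have a1 := adjoint_of_lowerTriangular h0 h1
  have a2 := adjoint_of_lowerTriangular h0' h1'
  constructor <;> intro y
  · simp only [add_apply, sub_apply, comp_apply, map_add, map_sub, h0, h0', (a1 y).1, (a2 y).1,
      ev0_obsOp]
    rw [obsOp_adjoint_apply y]
    simp only [coefR₀, coefΓ, coefLin_add_apply, coefLin_sub_apply, coefLin_mul_apply, map_add,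
      map_sub, Matrix.conjTranspose_add, Matrix.conjTranspose_sub, Matrix.conjTranspose_mul,
      Matrix.conjTranspose_conjTranspose, hP₁'.eq, hP₂'.eq]
    abel
  -- The difference of the two Stein equations: the terms `W B_j B_j^* W^*` produced in the tail
  -- corner are exactly what `W A Δ A^* W^*` lacks to be `W Δ W^*`.
  · have e : ∀ w, coefLin (P₁ - P₂) w = coefLin A (coefLin (P₁ - P₂) (coefLin Aᴴ w)) +
        (coefLin B₁ (coefLin B₁ᴴ w) - coefLin B₂ (coefLin B₂ᴴ w)) := fun w => by
      simp only [← coefLin_mul_apply, ← coefLin_add_apply, ← coefLin_sub_apply]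
      rw [← hP₁, ← hP₂]
      congr 2
      noncomm_ring
    simp only [add_apply, sub_apply, comp_apply, map_add, map_sub, h1, h1', (a1 y).1, (a2 y).1,
      (a1 y).2, (a2 y).2, bshift_obsOp]
    rw [obsOp_adjoint_apply y, e ((obsOp C A hA)⋆ (bshift m y))]
    simp only [coefΓ, coefLin_add_apply, coefLin_sub_apply, coefLin_mul_apply, map_add,
      map_sub]
    abel

/-- The tail corner of `T` is `T` itself, so the quadratic form is invariant under the forward
shift. -/
theorem inner_bshift_adjoint_pow (h : HasBlockForm hA C R₀ Γ T) (y : Seq m) (j : ℕ) :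
    inner ℂ (T (((bshift m)⋆ ^ j) y)) (((bshift m)⋆ ^ j) y) = inner ℂ (T y) y := by
  induction j with
  | zero => rfl
  | succ j ih =>
    rw [pow_succ', mul_apply_eq_comp, adjoint_inner_right, h.bshift_apply, ev0_bshift_adjoint,
      map_zero, map_zero, zero_add, bshift_bshift_adjoint, ih]

theorem norm_bshift_adjoint_pow (y : Seq m) (j : ℕ) : ‖((bshift m)⋆ ^ j) y‖ = ‖y‖ := by
  induction j with
  | zero => rfl
  | succ j ih =>
    rw [← ih, pow_succ', mul_apply_eq_comp, ← sq_eq_sq₀ (norm_nonneg _) (norm_nonneg _),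
      norm_sq_eq_ev0_add_bshift, ev0_bshift_adjoint, bshift_bshift_adjoint, norm_zero]
    ring

theorem obsOp_adjoint_bshift_adjoint_pow (y : Seq m) (j : ℕ) :
    (obsOp C A hA)⋆ (((bshift m)⋆ ^ j) y) = (coefLin Aᴴ ^ j) ((obsOp C A hA)⋆ y) := by
  induction j with
  | zero => rfl
  | succ j ih =>
    rw [pow_succ', mul_apply_eq_comp, obsOp_adjoint_apply, ev0_bshift_adjoint,
      bshift_bshift_adjoint, ih, map_zero, zero_add, pow_succ', mul_apply_eq_comp]

/-- A lower bound for `T - W Δ W^*` is a lower bound for `T`. -/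
theorem HasBlockForm.le_inner (h : HasBlockForm hA C R₀ Γ T) {Δ : Matrix (Fin n) (Fin n) ℂ}
    {L : Seq m →L[ℂ] Seq m} (hT : T = L + obsOp C A hA ∘L coefLin Δ ∘L (obsOp C A hA)⋆) {ε : ℝ}
    (hL : ∀ y, ε * ‖y‖ ^ 2 ≤ (inner ℂ (L y) y).re) (y : Seq m) :
    ε * ‖y‖ ^ 2 ≤ (inner ℂ (T y) y).re := by
  set u := (obsOp C A hA)⋆ y with hu
  -- The bound for `L` is tested on the `j`-fold forward shift of `y`; only the correction term
  -- depends on `j`, and it vanishes in the limit.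
  have h1 : ∀ j : ℕ, ε * ‖y‖ ^ 2 +
      (inner ℂ (coefLin Δ ((coefLin Aᴴ ^ j) u)) ((coefLin Aᴴ ^ j) u)).re
        ≤ (inner ℂ (T y) y).re := fun j => by
    rw [← inner_bshift_adjoint_pow h y j]
    conv_rhs => rw [hT]
    rw [add_apply, inner_add_left, Complex.add_re, comp_apply, comp_apply,
      ← adjoint_inner_right (obsOp C A hA), obsOp_adjoint_bshift_adjoint_pow]
    refine add_le_add ?_ le_rfl
    rw [← norm_bshift_adjoint_pow y j]
    exact hL _
  have h2 : Tendsto (fun j : ℕ => (coefLin Aᴴ ^ j) u) atTop (𝓝 0) := by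
    have h := ((ContinuousLinearMap.apply ℂ (EuclideanSpace ℂ (Fin n)) u).continuous.tendsto 0).comp
      hA.conjTranspose.tendsto
    rw [map_zero] at h
    exact h
  have h3 : Tendsto (fun j : ℕ => ε * ‖y‖ ^ 2 +
      (inner ℂ (coefLin Δ ((coefLin Aᴴ ^ j) u)) ((coefLin Aᴴ ^ j) u)).re) atTop
      (𝓝 (ε * ‖y‖ ^ 2 + (inner ℂ (coefLin Δ (0 : EuclideanSpace ℂ (Fin n)))
        (0 : EuclideanSpace ℂ (Fin n))).re)) :=
    ((Complex.continuous_re.tendsto _).comp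
      ((((coefLin Δ).continuous.tendsto 0).comp h2).inner h2)).const_add _
  rw [inner_zero_right, Complex.zero_re, add_zero] at h3
  exact le_of_tendsto' h3 h1

end Block

/-! ### Strict positivity -/

section StrictPos

variable {H : Type*} [NormedAddCommGroup H] [InnerProductSpace ℂ H] [CompleteSpace H]

/-- `⟨T y, y⟩ = ‖T^{1/2} y‖²` and `T^{1/2}` is invertible with inverse `N`. The constant uses `‖N‖ +
1` so that it is positive even on the zero space. -/
theorem exists_le_inner_of_isStrictlyPositive {T : H →L[ℂ] H} (hT : IsStrictlyPositive T) :
    ∃ ε : ℝ, 0 < ε ∧ ∀ y, ε * ‖y‖ ^ 2 ≤ (inner ℂ (T y) y).re := by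
  have hs := hT.isUnit_cfcSqrt
  have hn : 0 ≤ CFC.sqrt T := CFC.sqrt_nonneg T
  have hsa := (ContinuousLinearMap.nonneg_iff_isPositive _ |>.1 hn).isSelfAdjoint
  have hm := CFC.sqrt_mul_sqrt_self T hT.nonneg
  set S := CFC.sqrt T
  obtain ⟨u, hu⟩ := hs
  set N : H →L[ℂ] H := ↑u⁻¹ with hN
  have h1 : N * S = 1 := by rw [hN, ← hu, Units.inv_mul]
  refine ⟨((‖N‖ + 1) ^ 2)⁻¹, by positivity, fun y => ?_⟩
  have h2 : (inner ℂ (T y) y).re = ‖S y‖ ^ 2 := by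
    rw [← hm, mul_apply_eq_comp]
    conv_lhs => rw [← hsa.adjoint_eq]
    rw [adjoint_inner_left, hsa.adjoint_eq, inner_self_eq_norm_sq_to_K]
    norm_cast
  have h3 : ‖y‖ ≤ (‖N‖ + 1) * ‖S y‖ := by
    have : y = N (S y) := by rw [← mul_apply_eq_comp, h1]; rfl
    calc ‖y‖ = ‖N (S y)‖ := by rw [← this]
      _ ≤ ‖N‖ * ‖S y‖ := N.le_opNorm _
      _ ≤ _ := by gcongr; linarith
  rw [h2, inv_mul_le_iff₀ (by positivity), ← mul_pow]
  gcongr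

theorem isStrictlyPositive_of_le_inner {T : H →L[ℂ] H} (hT : T⋆ = T) {ε : ℝ} (hε : 0 < ε)
    (h : ∀ y, ε * ‖y‖ ^ 2 ≤ (inner ℂ (T y) y).re) : IsStrictlyPositive T := by
  refine IsStrictlyPositive.iff_of_unital.2 ⟨?_, ?_⟩
  · rw [ContinuousLinearMap.nonneg_iff_isPositive, ContinuousLinearMap.isPositive_def']
    refine ⟨hT, fun y => le_trans ?_ (h y)⟩
    positivity
  · refine isUnit_of_forall_le_norm_inner_map T (c := ⟨ε, hε.le⟩) hε fun y => ?_
    refine le_trans ?_ (Complex.re_le_norm _)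
    refine le_trans (le_of_eq ?_) (h y)
    change ‖y‖ ^ 2 * ε = _
    ring

theorem adjoint_eq_of_isStrictlyPositive {T : H →L[ℂ] H} (hT : IsStrictlyPositive T) : T⋆ = T :=
  ((ContinuousLinearMap.nonneg_iff_isPositive _).1 hT.nonneg).isSelfAdjoint.adjoint_eq

end StrictPos

/-! ### Positive definite matrices -/

theorem isHermitian_iff_inner_coefLin {M : Matrix (Fin n) (Fin n) ℂ} :
    M.IsHermitian ↔ ∀ x y, inner ℂ (coefLin M x) y = inner ℂ x (coefLin M y) := by
  refine ⟨fun h x y => by rw [inner_coefLin_left, h.eq], fun h => ?_⟩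
  apply coefLin_injective
  rw [← coefLin_adjoint]
  ext1 x
  refine ext_inner_right ℂ fun y => ?_
  rw [adjoint_inner_left, h]

theorem posDef_of_re_inner_pos {M : Matrix (Fin n) (Fin n) ℂ} (hM : M.IsHermitian)
    (h : ∀ x : EuclideanSpace ℂ (Fin n), x ≠ 0 → 0 < (inner ℂ (coefLin M x) x).re) :
    M.PosDef := by
  refine posDef_iff_inner_coefLin.2 ⟨hM, fun x hx => ?_⟩
  have h1 := isHermitian_iff_inner_coefLin.1 hM x x
  rw [← h1, Complex.pos_iff]
  refine ⟨h x hx, ?_⟩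
  have h2 : conj (inner ℂ (coefLin M x) x) = inner ℂ (coefLin M x) x := by
    rw [inner_conj_symm, h1]
  exact (Complex.conj_eq_iff_im.1 h2).symm

theorem isStrictlyPositive_coefLin {M : Matrix (Fin n) (Fin n) ℂ} (hM : M.PosDef) :
    IsStrictlyPositive (coefLin M) := by
  refine IsStrictlyPositive.iff_of_unital.2 ⟨?_, ?_⟩
  · rw [ContinuousLinearMap.nonneg_iff_isPositive, ContinuousLinearMap.isPositive_def']
    refine ⟨?_, fun x => ?_⟩
    · rw [IsSelfAdjoint, star_eq_adjoint, coefLin_adjoint, hM.isHermitian.eq]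
    · rcases eq_or_ne x 0 with rfl | hx
      · simp [reApplyInnerSelf]
      · have h := (posDef_iff_inner_coefLin.1 hM).2 x hx
        rw [reApplyInnerSelf, inner_coefLin_left, hM.isHermitian.eq]
        exact (Complex.pos_iff.1 h).1.le
  · exact hM.isUnit.map (Matrix.toEuclideanCLM (n := Fin n) (𝕜 := ℂ))

section Riccati

variable {A : Matrix (Fin n) (Fin n) ℂ} {hA : IsStable A} {C : Matrix (Fin m) (Fin n) ℂ}
  {R₀ : Matrix (Fin m) (Fin m) ℂ} {Γ : Matrix (Fin n) (Fin m) ℂ} {T : Seq m →L[ℂ] Seq m}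

theorem HasBlockForm.isHermitian (h : HasBlockForm hA C R₀ Γ T) (hT : T⋆ = T) :
    R₀.IsHermitian := by
  have h1 : ∀ v w, inner ℂ (coefLin R₀ v) w = inner ℂ (T ((ev0 m)⋆ v)) ((ev0 m)⋆ w) :=
    fun v w => by
      rw [adjoint_inner_right, h.ev0_apply, ev0_ev0_adjoint, bshift_ev0_adjoint, map_zero, map_zero,
        add_zero]
  refine isHermitian_iff_inner_coefLin.2 fun v w => ?_
  rw [h1, ← inner_conj_symm v, h1, inner_conj_symm, ← adjoint_inner_right, hT]

/-! ### From strict positivity to the Riccati equation -/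

/-- The entries of `y` form the geometric sequence `μ ^ j • y 0`, which must tend to zero. -/
theorem norm_lt_one_of_bshift_eq_smul {y : Seq m} (hy : y ≠ 0) {μ : ℂ}
    (h : bshift m y = μ • y) : ‖μ‖ < 1 := by
  by_contra! hμ
  have h1 : ∀ j, y j = μ ^ j • y 0 := fun j => by
    induction j with
    | zero => simp
    | succ j ih =>
      rw [← Leech.bshift_apply, h, lp.coeFn_smul, Pi.smul_apply, ih, smul_smul, pow_succ']
  have h2 : ∀ j, ‖y 0‖ ≤ ‖y j‖ := fun j => by
    rw [h1 j, norm_smul, norm_pow]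
    exact le_mul_of_one_le_left (norm_nonneg _) (one_le_pow₀ hμ)
  have h3 : ‖y 0‖ ≤ 0 := ge_of_tendsto' (tendsto_zero_iff_norm_tendsto_zero.1
    (tendsto_seq_apply y)) h2
  refine hy (lp.ext (funext fun j => ?_))
  rw [h1 j, norm_le_zero_iff.1 h3, smul_zero]
  rfl

/-- If `T` is strictly positive, then `W^* T⁻¹ W` is a stabilizing solution. -/
theorem HasBlockForm.exists_isStabilizingSolution (h : HasBlockForm hA C R₀ Γ T)
    (hobs : Function.Injective (obsOp C A hA)) (hT : IsStrictlyPositive T) :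
    ∃ Q, IsStabilizingSolution A C R₀ Γ Q := by
  have hTa := adjoint_eq_of_isStrictlyPositive hT
  have hR := h.isHermitian hTa
  obtain ⟨ε, hε, hpos⟩ := exists_le_inner_of_isStrictlyPositive hT
  have hpos' : ∀ y : Seq m, y ≠ 0 → 0 < (inner ℂ (T y) y).re := fun y hy =>
    lt_of_lt_of_le (by have := norm_pos_iff.2 hy; positivity) (hpos y)
  have hinj : Function.Injective T := (isUnit_iff_bijective.1 hT.isUnit).1
  set W := obsOp C A hA with hW
  let X : EuclideanSpace ℂ (Fin n) →L[ℂ] Seq m := Ring.inverse T ∘L W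
  have hTX : ∀ x, T (X x) = W x := fun x => by
    have := Ring.mul_inverse_cancel T hT.isUnit
    change (T * Ring.inverse T) (W x) = _
    rw [this]
    rfl
  clear_value X
  obtain ⟨C₀, hC₀⟩ := coefLin_surjective (ev0 m ∘L X)
  obtain ⟨Q, hQ⟩ := coefLin_surjective (W⋆ ∘L X)
  have hC₀' : ∀ x, ev0 m (X x) = coefLin C₀ x := fun x => by rw [hC₀]; rfl
  have hQ' : ∀ x, W⋆ (X x) = coefLin Q x := fun x => by rw [hQ]; rfl
  -- The tail row of `T X = W` reads `W Γ C₀ + T S^* X = W A`, hence `T S^* X = W (A - Γ C₀) = T X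
  -- (A - Γ C₀)`, and `T` is injective.
  have hBX : ∀ x, bshift m (X x) = X (coefLin (A - Γ * C₀) x) := fun x => by
    apply hinj
    have h1 := h.bshift_apply (X x)
    rw [hTX, hC₀', bshift_obsOp] at h1
    rw [hTX, coefLin_sub_apply, coefLin_mul_apply, map_sub, h1, add_sub_cancel_left]
  have hQX : ∀ x y, inner ℂ (coefLin Q x) y = inner ℂ (X x) (T (X y)) := fun x y => by
    rw [← hQ', adjoint_inner_left, hTX]
  have hQh : Q.IsHermitian := isHermitian_iff_inner_coefLin.2 fun x y => by
    rw [hQX, ← inner_conj_symm x, hQX, inner_conj_symm, ← adjoint_inner_left, hTa]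
  have hX0 : ∀ x, x ≠ 0 → X x ≠ 0 := fun x hx h0 => hx (hobs (by
    rw [← hTX, h0, map_zero, map_zero]))
  have hs : (R₀ - Γᴴ * Q * Γ).PosDef := by
    refine posDef_of_re_inner_pos ?_ fun v hv => ?_
    · refine hR.sub ?_
      rw [Matrix.IsHermitian, Matrix.conjTranspose_mul, Matrix.conjTranspose_mul, hQh.eq,
        Matrix.conjTranspose_conjTranspose, Matrix.mul_assoc]
    -- The Schur complement test vector `(v, -X Γ v)`: since `T X = W`, the tail of `T y` vanishes.
    · set y := (ev0 m)⋆ v - (bshift m)⋆ (X (coefLin Γ v)) with hy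
      have h0 : ev0 m y = v := by
        rw [hy, map_sub, ev0_ev0_adjoint, ev0_bshift_adjoint, sub_zero]
      have h1 : bshift m y = -X (coefLin Γ v) := by
        rw [hy, map_sub, bshift_ev0_adjoint, bshift_bshift_adjoint, zero_sub]
      have h2 : inner ℂ (T y) y = inner ℂ (coefLin (R₀ - Γᴴ * Q * Γ) v) v := by
        rw [inner_eq_ev0_add_bshift, h.ev0_apply, h.bshift_apply, h0, h1, map_neg, map_neg, map_neg,
          hQ', hTX, add_neg_cancel, inner_zero_left, add_zero, coefLin_sub_apply,
          coefLin_mul_apply, coefLin_mul_apply, sub_eq_add_neg]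
      rw [← h2]
      refine hpos' y fun h3 => hv ?_
      rw [← h0, h3, map_zero]
  have hsC : (R₀ - Γᴴ * Q * Γ) * C₀ = C - Γᴴ * Q * A := by
    apply coefLin_injective
    ext1 x
    have h1 := h.ev0_apply (X x)
    rw [hTX, ev0_obsOp, hC₀', hBX, hQ'] at h1
    simp only [coefLin_sub_apply, coefLin_mul_apply, map_sub] at h1 ⊢
    rw [h1]
    abel
  have hC₁ : (R₀ - Γᴴ * Q * Γ)⁻¹ * (C - Γᴴ * Q * A) = C₀ := by
    rw [← hsC, Matrix.nonsing_inv_mul_cancel_left _ _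
      ((Matrix.isUnit_iff_isUnit_det _).1 hs.isUnit)]
  have hQ₁ : Q = Cᴴ * C₀ + Aᴴ * Q * (A - Γ * C₀) := by
    apply coefLin_injective
    ext1 x
    rw [← hQ', obsOp_adjoint_apply, hC₀', hBX, hQ', coefLin_add_apply, coefLin_mul_apply,
      coefLin_mul_apply, coefLin_mul_apply]
  refine ⟨Q, posDef_of_re_inner_pos hQh fun x hx => ?_, hs, ?_, ?_⟩
  · rw [hQX, ← adjoint_inner_left, hTa]
    exact hpos' _ (hX0 x hx)
  · rw [Matrix.mul_assoc _ (R₀ - Γᴴ * Q * Γ)⁻¹, hC₁]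
    conv_lhs => rw [hQ₁]
    simp only [Matrix.conjTranspose_sub, Matrix.conjTranspose_mul, hQh.eq,
      Matrix.conjTranspose_conjTranspose, Matrix.mul_sub, Matrix.sub_mul, Matrix.mul_assoc]
    abel
  · rw [Matrix.mul_assoc Γ, hC₁]
    -- `X` maps an eigenvector of `A - Γ C₀` to an eigenvector of the backward shift, nonzero by
    -- observability.
    refine isStable_of_eigenvector fun μ v hv hμ => ?_
    refine norm_lt_one_of_bshift_eq_smul (hX0 v hv) ?_
    rw [hBX, hμ, map_smul]

/-! ### From the Riccati equation to strict positivity -/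

/-- Completing the square in the block form. The remaining form is again that of `T`, which is what
allows iteration. -/
theorem HasBlockForm.inner_eq (h : HasBlockForm hA C R₀ Γ T) (hT : T⋆ = T)
    {X : EuclideanSpace ℂ (Fin n) →L[ℂ] Seq m} (hTX : ∀ x, T (X x) = obsOp C A hA x)
    {Q : Matrix (Fin n) (Fin n) ℂ} (hQ : ∀ x, (obsOp C A hA)⋆ (X x) = coefLin Q x) (w : Seq m) :
    inner ℂ (T w) w = inner ℂ (coefLin (R₀ - Γᴴ * Q * Γ) (ev0 m w)) (ev0 m w) +
      inner ℂ (T (bshift m w + X (coefLin Γ (ev0 m w))))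
        (bshift m w + X (coefLin Γ (ev0 m w))) := by
  have h1 : inner ℂ (T (bshift m w)) (X (coefLin Γ (ev0 m w)))
      = inner ℂ (coefLin Γᴴ ((obsOp C A hA)⋆ (bshift m w))) (ev0 m w) := by
    rw [inner_coefLin_left, Matrix.conjTranspose_conjTranspose, adjoint_inner_left, ← hTX,
      ← adjoint_inner_left T, hT]
  have h2 : inner ℂ (obsOp C A hA (coefLin Γ (ev0 m w))) (X (coefLin Γ (ev0 m w)))
      = inner ℂ (coefLin (Γᴴ * Q * Γ) (ev0 m w)) (ev0 m w) := by
    rw [coefLin_mul_apply, coefLin_mul_apply, inner_coefLin_left (Γᴴ),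
      Matrix.conjTranspose_conjTranspose, ← hQ, adjoint_inner_left, ← hTX,
      ← adjoint_inner_left T, hT]
  rw [inner_eq_ev0_add_bshift, h.ev0_apply, h.bshift_apply, map_add T, hTX]
  simp only [inner_add_left, inner_add_right, h1, h2, coefLin_sub_apply, inner_sub_left]
  ring

/-- A stabilizing solution `Q` makes `T` strictly positive, and `Q = W^* T⁻¹ W`. -/
theorem HasBlockForm.isStrictlyPositive_and_eq (h : HasBlockForm hA C R₀ Γ T) (hT : T⋆ = T)
    {Q : Matrix (Fin n) (Fin n) ℂ} (hQ : IsStabilizingSolution A C R₀ Γ Q) :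
    IsStrictlyPositive T ∧ ∃ X : EuclideanSpace ℂ (Fin n) →L[ℂ] Seq m,
      (∀ x, T (X x) = obsOp C A hA x) ∧ ∀ x, (obsOp C A hA)⋆ (X x) = coefLin Q x := by
  obtain ⟨hQp, hs, hric, hst⟩ := hQ
  have hQh := hQp.isHermitian
  set s := R₀ - Γᴴ * Q * Γ with hsdef
  set C₀ := s⁻¹ * (C - Γᴴ * Q * A) with hC₀
  have hA₀' : A - Γ * s⁻¹ * (C - Γᴴ * Q * A) = A - Γ * C₀ := by rw [hC₀, Matrix.mul_assoc]
  rw [hA₀'] at hst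
  have hsC : s * C₀ = C - Γᴴ * Q * A :=
    Matrix.mul_nonsing_inv_cancel_left _ _ ((Matrix.isUnit_iff_isUnit_det _).1 hs.isUnit)
  have hQ₁ : Q = Cᴴ * C₀ + Aᴴ * Q * (A - Γ * C₀) := by
    rw [Matrix.mul_assoc _ s⁻¹, ← hC₀] at hric
    conv_lhs => rw [hric]
    simp only [Matrix.conjTranspose_sub, Matrix.conjTranspose_mul, hQh.eq,
      Matrix.conjTranspose_conjTranspose, Matrix.mul_sub, Matrix.sub_mul, Matrix.mul_assoc]
    abel
  set X := obsOp C₀ (A - Γ * C₀) hst with hX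
  have hQX : ∀ x, (obsOp C A hA)⋆ (X x) = coefLin Q x := by
    obtain ⟨Q', hQ'⟩ := coefLin_surjective ((obsOp C A hA)⋆ ∘L X)
    have h1 : ∀ x, (obsOp C A hA)⋆ (X x) = coefLin Q' x := fun x => by rw [hQ']; rfl
    have h2 : Q' = Cᴴ * C₀ + Aᴴ * Q' * (A - Γ * C₀) := by
      apply coefLin_injective
      ext1 x
      rw [← h1, obsOp_adjoint_apply, ev0_obsOp, bshift_obsOp, ← hX, h1, coefLin_add_apply,
        coefLin_mul_apply Cᴴ, coefLin_mul_apply (Aᴴ * Q'), coefLin_mul_apply Aᴴ]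
    -- `Q' = W^* X` and `Q` satisfy the same affine equation, so their difference solves `Z = A^* Z
    -- (A - Γ C₀)`.
    have h3 : Q' - Q = 0 := by
      refine hA.conjTranspose.eq_zero_of_stein hst ?_
      conv_lhs => rw [h2, hQ₁]
      rw [add_sub_add_left_eq_sub, Matrix.mul_sub Aᴴ, Matrix.sub_mul]
    intro x
    rw [h1, sub_eq_zero.1 h3]
  have hTX : ∀ x, T (X x) = obsOp C A hA x := by
    have h1 : T ∘L X - obsOp C A hA = 0 := by
      refine eq_zero_of_intertwine (M := coefLin (A - Γ * C₀)) (fun x => ?_) fun x => ?_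
      · rw [sub_apply, sub_apply, comp_apply, comp_apply, map_sub, h.bshift_apply, ev0_obsOp,
          bshift_obsOp, bshift_obsOp, ← hX, coefLin_sub_apply A, coefLin_mul_apply Γ, map_sub,
          map_sub, map_sub]
        abel
      · have h2 : coefLin s (coefLin C₀ x) = coefLin C x - coefLin (Γᴴ * Q * A) x := by
          rw [← coefLin_mul_apply, hsC, coefLin_sub_apply]
        rw [sub_apply, comp_apply, map_sub, h.ev0_apply, ev0_obsOp, ev0_obsOp, bshift_obsOp, ← hX,
          hQX]
        simp only [hsdef, coefLin_sub_apply, coefLin_mul_apply, map_sub] at h2 ⊢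
        rw [sub_eq_iff_eq_add] at h2
        rw [h2]
        abel
    intro x
    exact sub_eq_zero.1 (DFunLike.congr_fun h1 x)
  refine ⟨?_, X, hTX, hQX⟩
  obtain ⟨σ, hσ, hσs⟩ := exists_le_inner_of_isStrictlyPositive (isStrictlyPositive_coefLin hs)
  -- `V` gives the states of `(A, Γ)` and `V₀` those of the closed loop `(A - Γ C₀, Γ)`. The maps `y
  -- ↦ y + K V y` and `g ↦ g - K V₀ g` are a system and its inverse.
  obtain ⟨V, hV⟩ := exists_stateOp hA Γ
  obtain ⟨V₀, hV₀⟩ := exists_stateOp hst Γ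
  set K : Seq n →L[ℂ] Seq m := layer (coefLin C₀) 0 with hK
  have hKapp : ∀ v j, K v j = coefLin C₀ (v j) := fun v j => by
    simp [hK, layer_apply, shiftFun]
  have key : ∀ y : Seq m, σ * ‖y + K (V y)‖ ^ 2 ≤ (inner ℂ (T y) y).re := fun y => by
    set g := y + K (V y) with hg
    have hgj : ∀ j, g j = y j + coefLin C₀ (V y j) := fun j => by
      rw [hg, lp.coeFn_add, Pi.add_apply, hKapp]
    -- The orbit of `y` under the map in `HasBlockForm.inner_eq`; its initial entries are the
    -- entries of `g`, and it tends to zero in norm.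
    set w : ℕ → Seq m := fun j => (bshift m ^ j) y + X (V y j) with hw
    have hw0 : w 0 = y := by
      simp only [hw, (hV y).1, map_zero, add_zero]
      rfl
    have hwE : ∀ j, ev0 m (w j) = g j := fun j => by
      simp only [hw]
      rw [map_add, ev0_bshift_pow, ev0_obsOp, hgj]
    have hwS : ∀ j, bshift m (w j) + X (coefLin Γ (ev0 m (w j))) = w (j + 1) := fun j => by
      rw [hwE, hgj]
      simp only [hw]
      rw [map_add, bshift_obsOp, (hV y).2 j, pow_succ', mul_apply_eq_comp, coefLin_sub_apply,
        coefLin_mul_apply]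
      simp only [map_add, map_sub]
      abel
    have h1 : ∀ j, inner ℂ (T y) y = ∑ i ∈ Finset.range j, inner ℂ (coefLin s (g i)) (g i) +
        inner ℂ (T (w j)) (w j) := fun j => by
      induction j with
      | zero => rw [Finset.sum_range_zero, zero_add, hw0]
      | succ j ih =>
        rw [ih, Finset.sum_range_succ, h.inner_eq hT hTX hQX (w j), hwS, hwE, ← hsdef, add_assoc]
    have hwt : Tendsto w atTop (𝓝 0) := by
      have h2 := (tendsto_bshift_pow y).add
        ((X.continuous.tendsto 0).comp (tendsto_seq_apply (V y)))
      rw [map_zero, add_zero] at h2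
      exact h2
    have h2 : ∀ j, σ * ∑ i ∈ Finset.range j, ‖g i‖ ^ 2 + (inner ℂ (T (w j)) (w j)).re
        ≤ (inner ℂ (T y) y).re := fun j => by
      rw [h1 j, Complex.add_re, Complex.re_sum, Finset.mul_sum]
      exact add_le_add (Finset.sum_le_sum fun i _ => hσs _) le_rfl
    have h3 := ((hasSum_norm_sq g).tendsto_sum_nat.const_mul σ).add
      ((Complex.continuous_re.tendsto _).comp
        (((T.continuous.tendsto 0).comp hwt).inner (𝕜 := ℂ) hwt))
    rw [inner_zero_right, Complex.zero_re, add_zero] at h3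
    exact le_of_tendsto' h3 h2
  have hinv : ∀ y : Seq m, y = (ContinuousLinearMap.id ℂ (Seq m) - K ∘L V₀) (y + K (V y)) :=
    fun y => by
      -- Feedback cancels: `(A - Γ C₀) v + Γ (y + C₀ v) = A v + Γ y`.
      have h1 : V₀ (y + K (V y)) = V y := by
        apply lp.ext
        funext j
        induction j with
        | zero => rw [(hV₀ _).1, (hV y).1]
        | succ j ih =>
          rw [(hV₀ _).2, (hV y).2, ih, lp.coeFn_add, Pi.add_apply, hKapp, coefLin_sub_apply,
            coefLin_mul_apply, map_add]
          abel
      rw [sub_apply, id_apply, comp_apply, h1, add_sub_cancel_right]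
  set c := ‖ContinuousLinearMap.id ℂ (Seq m) - K ∘L V₀‖ with hc
  refine isStrictlyPositive_of_le_inner hT (ε := σ / (c + 1) ^ 2) (by positivity) fun y => ?_
  refine le_trans ?_ (key y)
  have h1 : ‖y‖ ≤ (c + 1) * ‖y + K (V y)‖ := by
    conv_lhs => rw [hinv y]
    refine (le_opNorm _ _).trans ?_
    rw [← hc]
    gcongr
    linarith
  rw [div_mul_eq_mul_div, div_le_iff₀ (by positivity), mul_assoc, mul_comm (‖_‖ ^ 2), ← mul_pow]
  gcongr

/-! ### Finite rank perturbation -/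

/-- The perturbed form is tested on `X Q⁻¹ u`, which `W^*` maps to `u`; its value there is the form
of `Q⁻¹ - Δ` at `u`. -/
theorem posDef_of_isStrictlyPositive {W X : EuclideanSpace ℂ (Fin n) →L[ℂ] Seq m}
    {Q Δ : Matrix (Fin n) (Fin n) ℂ} (hQ : Q.PosDef) (hΔ : Δ.IsHermitian)
    (hTX : ∀ x, T (X x) = W x) (hQX : ∀ x, W⋆ (X x) = coefLin Q x)
    (hL : IsStrictlyPositive (T - W ∘L coefLin Δ ∘L W⋆)) : (Q⁻¹ - Δ).PosDef := by
  obtain ⟨ε, hε, hpos⟩ := exists_le_inner_of_isStrictlyPositive hL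
  have hQu := (Matrix.isUnit_iff_isUnit_det _).1 hQ.isUnit
  refine posDef_of_re_inner_pos (hQ.isHermitian.inv.sub hΔ) fun u hu => ?_
  have h1 : W⋆ (X (coefLin Q⁻¹ u)) = u := by
    rw [hQX, ← coefLin_mul_apply, Matrix.mul_nonsing_inv _ hQu, coefLin_one_apply]
  have h2 : X (coefLin Q⁻¹ u) ≠ 0 := fun h0 => hu (by rw [← h1, h0, map_zero])
  have h3 := hpos (X (coefLin Q⁻¹ u))
  rw [sub_apply, comp_apply, comp_apply, h1, hTX, ← map_sub, ← adjoint_inner_right, h1,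
    ← coefLin_sub_apply] at h3
  refine lt_of_lt_of_le ?_ h3
  have := norm_pos_iff.2 h2
  positivity

/-- `x - X Q⁻¹ W^* x` is annihilated by `W^*`, hence orthogonal to the range of `X` in the form of
`T`; the cross terms vanish. -/
theorem inner_perturbation (hT : T⋆ = T) {W X : EuclideanSpace ℂ (Fin n) →L[ℂ] Seq m}
    {Q Δ : Matrix (Fin n) (Fin n) ℂ} (hQ : Q.PosDef)
    (hTX : ∀ x, T (X x) = W x) (hQX : ∀ x, W⋆ (X x) = coefLin Q x) (x : Seq m) :
    inner ℂ ((T - W ∘L coefLin Δ ∘L W⋆) x) x =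
      inner ℂ (T (x - X (coefLin Q⁻¹ (W⋆ x)))) (x - X (coefLin Q⁻¹ (W⋆ x))) +
      inner ℂ (coefLin (Q⁻¹ - Δ) (W⋆ x)) (W⋆ x) := by
  have hQu := (Matrix.isUnit_iff_isUnit_det _).1 hQ.isUnit
  have h1 : W⋆ (X (coefLin Q⁻¹ (W⋆ x))) = W⋆ x := by
    rw [hQX, ← coefLin_mul_apply, Matrix.mul_nonsing_inv _ hQu, coefLin_one_apply]
  have h2 : inner ℂ (T x) (X (coefLin Q⁻¹ (W⋆ x))) = inner ℂ (W⋆ x) (coefLin Q⁻¹ (W⋆ x)) := by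
    rw [← adjoint_inner_right, hT, hTX, adjoint_inner_left]
  have h3 : ∀ v, inner ℂ (W v) x = inner ℂ v (W⋆ x) := fun v => by rw [adjoint_inner_right]
  have h4 : inner ℂ (W (coefLin Q⁻¹ (W⋆ x))) (X (coefLin Q⁻¹ (W⋆ x)))
      = inner ℂ (coefLin Q⁻¹ (W⋆ x)) (W⋆ x) := by
    rw [← adjoint_inner_right, h1]
  have h5 : inner ℂ (coefLin Q⁻¹ (W⋆ x)) (W⋆ x) = inner ℂ (W⋆ x) (coefLin Q⁻¹ (W⋆ x)) :=
    isHermitian_iff_inner_coefLin.1 hQ.isHermitian.inv _ _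
  rw [map_sub T, hTX]
  simp only [sub_apply, comp_apply, coefLin_sub_apply, inner_sub_left, inner_sub_right, h2, h3, h4,
    h5]
  ring

/-- The Woodbury formula with `W^* T⁻¹ W = Q`. The two relations on `Ω` give the right and the left
inverse respectively. -/
theorem ringInverse_perturbation (hT : IsStrictlyPositive T)
    {W X : EuclideanSpace ℂ (Fin n) →L[ℂ] Seq m}
    {Q Δ Ω : Matrix (Fin n) (Fin n) ℂ}
    (hTX : ∀ x, T (X x) = W x) (hQX : ∀ x, W⋆ (X x) = coefLin Q x)
    (h1 : Ω - Δ * Q * Ω = Δ) (h2 : Ω - Ω * Q * Δ = Δ) :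
    IsUnit (T - W ∘L coefLin Δ ∘L W⋆) ∧
      Ring.inverse (T - W ∘L coefLin Δ ∘L W⋆) = Ring.inverse T +
        Ring.inverse T ∘L W ∘L coefLin Ω ∘L W⋆ ∘L Ring.inverse T := by
  set N := Ring.inverse T with hN
  have hTN : ∀ x, T (N x) = x := fun x => by
    rw [← mul_apply_eq_comp, Ring.mul_inverse_cancel T hT.isUnit]; rfl
  have hNT : ∀ x, N (T x) = x := fun x => by
    rw [← mul_apply_eq_comp, Ring.inverse_mul_cancel T hT.isUnit]; rfl
  have hNW : ∀ x, N (W x) = X x := fun x => by rw [← hTX, hNT]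
  have hΩ1 : ∀ v, coefLin Ω v - coefLin Δ (coefLin Q (coefLin Ω v)) = coefLin Δ v := fun v => by
    simp only [← coefLin_mul_apply, ← coefLin_sub_apply, ← Matrix.mul_assoc, h1]
  have hΩ2 : ∀ v, coefLin Ω v - coefLin Ω (coefLin Q (coefLin Δ v)) = coefLin Δ v := fun v => by
    simp only [← coefLin_mul_apply, ← coefLin_sub_apply, ← Matrix.mul_assoc, h2]
  have hLM : (T - W ∘L coefLin Δ ∘L W⋆) * (N + N ∘L W ∘L coefLin Ω ∘L W⋆ ∘L N) = 1 := by
    ext1 x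
    rw [mul_apply_eq_comp, one_apply_eq_self]
    simp only [sub_apply, add_apply, comp_apply, hNW, map_add, hTN, hTX, hQX]
    conv_rhs => rw [← add_zero x]
    rw [← hΩ1 (W⋆ (N x)), map_sub]
    abel
  have hML : (N + N ∘L W ∘L coefLin Ω ∘L W⋆ ∘L N) * (T - W ∘L coefLin Δ ∘L W⋆) = 1 := by
    ext1 x
    rw [mul_apply_eq_comp, one_apply_eq_self]
    simp only [sub_apply, add_apply, comp_apply, hNW, map_sub, hNT, hQX]
    conv_rhs => rw [← add_zero x]
    have h3 : X (coefLin Ω (W⋆ x)) - X (coefLin Ω (coefLin Q (coefLin Δ (W⋆ x))))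
        = X (coefLin Δ (W⋆ x)) := by rw [← map_sub, hΩ2]
    rw [← h3]
    abel
  let u : (Seq m →L[ℂ] Seq m)ˣ := ⟨_, _, hLM, hML⟩
  exact ⟨u.isUnit, Ring.inverse_unit u⟩

end Riccati

/-! ### The operators of the realization -/

/-- The adjoint of a solution is a solution, and solutions are unique. -/
theorem IsStable.isHermitian_of_stein {A P : Matrix (Fin n) (Fin n) ℂ} (hA : IsStable A)
    {B : Matrix (Fin n) (Fin r) ℂ} (hP : P - A * P * Aᴴ = B * Bᴴ) : P.IsHermitian := by
  have h1 : Pᴴ - A * Pᴴ * Aᴴ = B * Bᴴ := by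
    have := congrArg Matrix.conjTranspose hP
    simpa [Matrix.mul_assoc] using this
  refine sub_eq_zero.1 (hA.eq_zero_of_stein hA.conjTranspose (Z := Pᴴ - P) ?_)
  rw [Matrix.mul_sub, Matrix.sub_mul, sub_eq_sub_iff_sub_eq_sub, h1, hP]

theorem IsRealization.eq_left {G : ℂ → Matrix (Fin m) (Fin p) ℂ}
    {K : ℂ → Matrix (Fin m) (Fin q) ℂ} {A : Matrix (Fin n) (Fin n) ℂ}
    {B₁ : Matrix (Fin n) (Fin p) ℂ} {B₂ : Matrix (Fin n) (Fin q) ℂ}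
    {C : Matrix (Fin m) (Fin n) ℂ} {D₁ : Matrix (Fin m) (Fin p) ℂ} {D₂ : Matrix (Fin m) (Fin q) ℂ}
    (h : IsRealization G K A B₁ B₂ C D₁ D₂) {z : ℂ} (hz : ‖z‖ ≤ 1) :
    G z = D₁ + z • (C * (1 - z • A)⁻¹ * B₁) := by
  ext i j
  have := congrFun (congrFun (h z hz) i) (Sum.inl j)
  rw [Matrix.mul_fromCols] at this
  simpa using this

theorem IsRealization.eq_right {G : ℂ → Matrix (Fin m) (Fin p) ℂ}
    {K : ℂ → Matrix (Fin m) (Fin q) ℂ} {A : Matrix (Fin n) (Fin n) ℂ}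
    {B₁ : Matrix (Fin n) (Fin p) ℂ} {B₂ : Matrix (Fin n) (Fin q) ℂ}
    {C : Matrix (Fin m) (Fin n) ℂ} {D₁ : Matrix (Fin m) (Fin p) ℂ} {D₂ : Matrix (Fin m) (Fin q) ℂ}
    (h : IsRealization G K A B₁ B₂ C D₁ D₂) {z : ℂ} (hz : ‖z‖ ≤ 1) :
    K z = D₂ + z • (C * (1 - z • A)⁻¹ * B₂) := by
  ext i j
  have := congrFun (congrFun (h z hz) i) (Sum.inr j)
  rw [Matrix.mul_fromCols] at this
  simpa using this

theorem toeplitz_lowerTriangular {A : Matrix (Fin n) (Fin n) ℂ} (hA : IsStable A)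
    {B : Matrix (Fin n) (Fin r) ℂ} {C : Matrix (Fin m) (Fin n) ℂ} {D : Matrix (Fin m) (Fin r) ℂ}
    {F : ℂ → Matrix (Fin m) (Fin r) ℂ} (hF : IsStableRational F)
    (h : ∀ z : ℂ, ‖z‖ ≤ 1 → F z = D + z • (C * (1 - z • A)⁻¹ * B)) :
    (∀ y, ev0 m (toeplitz F y) = coefLin D (ev0 r y)) ∧
      ∀ y, bshift m (toeplitz F y) =
        obsOp C A hA (coefLin B (ev0 r y)) + toeplitz F (bshift r y) := by
  have h1 := fourierCoef_eq_realCoef hA (F := F) (B := B) (C := C) (D := D)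
    (B' := (0 : Matrix (Fin n) (Fin m) ℂ)) (C' := (0 : Matrix (Fin r) (Fin n) ℂ))
    fun z hz => by rw [h z hz.le]; simp
  refine ⟨fun y => ?_, hF.isToeplitz.bshift_apply hA h1⟩
  rw [hF.isToeplitz.ev0_apply hA h1, Matrix.conjTranspose_zero, coefLin_zero, zero_apply, add_zero]

theorem hasBlockForm_symbolR {G : ℂ → Matrix (Fin m) (Fin p) ℂ}
    {K : ℂ → Matrix (Fin m) (Fin q) ℂ} (hG : IsStableRational G) (hK : IsStableRational K)
    {A : Matrix (Fin n) (Fin n) ℂ} {B₁ : Matrix (Fin n) (Fin p) ℂ} {B₂ : Matrix (Fin n) (Fin q) ℂ}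
    {C : Matrix (Fin m) (Fin n) ℂ} {D₁ : Matrix (Fin m) (Fin p) ℂ} {D₂ : Matrix (Fin m) (Fin q) ℂ}
    (h : IsRealization G K A B₁ B₂ C D₁ D₂) (hA : IsStable A) {P₁ P₂ : Matrix (Fin n) (Fin n) ℂ}
    (hP₁ : P₁ - A * P₁ * Aᴴ = B₁ * B₁ᴴ) (hP₂ : P₂ - A * P₂ * Aᴴ = B₂ * B₂ᴴ) :
    HasBlockForm hA C (coefR₀ C D₁ D₂ P₁ P₂) (coefΓ A B₁ B₂ C D₁ D₂ P₁ P₂)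
      (toeplitz (symbolR G K)) := by
  have h1 : ∀ l, fourierCoef (symbolR G K) l = realCoef A (coefΓ A B₁ B₂ C D₁ D₂ P₁ P₂) C
      (coefR₀ C D₁ D₂ P₁ P₂) (coefΓ A B₁ B₂ C D₁ D₂ P₁ P₂) C l := by
    refine fourierCoef_eq_realCoef hA fun z hz => ?_
    have hz1 : (conj z)⁻¹ = z := by
      rw [Complex.inv_def, Complex.conj_conj, Complex.normSq_conj, Complex.normSq_eq_norm_sq, hz]
      simp
    rw [symbolR, hz1, h.eq_left hz.le, h.eq_right hz.le,
      symbolR_eq hA (hA.isHermitian_of_stein hP₁) C D₁ hP₁ hz,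
      symbolR_eq hA (hA.isHermitian_of_stein hP₂) C D₂ hP₂ hz]
    have e : coefΓ A B₁ B₂ C D₁ D₂ P₁ P₂
        = (B₁ * D₁ᴴ + A * P₁ * Cᴴ) - (B₂ * D₂ᴴ + A * P₂ * Cᴴ) := by
      simp only [coefΓ, Matrix.mul_sub, Matrix.sub_mul]
      abel
    rw [e, Matrix.mul_sub, smul_sub, Matrix.conjTranspose_sub, coefR₀, Matrix.mul_sub,
      Matrix.sub_mul]
    abel
  exact ⟨(isToeplitz_symbolR hG hK).ev0_apply hA h1, (isToeplitz_symbolR hG hK).bshift_apply hA h1⟩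

end

end Leech

/-! ### The main theorem -/

open Leech
theorem theorem1p1 {m n p q : ℕ}
    (G : ℂ → Matrix (Fin m) (Fin p) ℂ) (K : ℂ → Matrix (Fin m) (Fin q) ℂ)
    (hG : IsStableRational G) (hK : IsStableRational K)
    (A : Matrix (Fin n) (Fin n) ℂ) (B₁ : Matrix (Fin n) (Fin p) ℂ)
    (B₂ : Matrix (Fin n) (Fin q) ℂ) (C : Matrix (Fin m) (Fin n) ℂ)
    (D₁ : Matrix (Fin m) (Fin p) ℂ) (D₂ : Matrix (Fin m) (Fin q) ℂ)
    (hreal : IsRealization G K A B₁ B₂ C D₁ D₂)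
    (hA : IsStable A) (hobs : Function.Injective (obsOp C A hA))
    (P₁ P₂ : Matrix (Fin n) (Fin n) ℂ)
    (hP₁ : P₁ - A * P₁ * Aᴴ = B₁ * B₁ᴴ) (hP₂ : P₂ - A * P₂ * Aᴴ = B₂ * B₂ᴴ)
    (R₀ : Matrix (Fin m) (Fin m) ℂ) (hR₀ : R₀ = coefR₀ C D₁ D₂ P₁ P₂)
    (Γ : Matrix (Fin n) (Fin m) ℂ) (hΓ : Γ = coefΓ A B₁ B₂ C D₁ D₂ P₁ P₂) :
    (IsStrictlyPositive (leechOp G K) ↔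
      ∃ Q, IsStabilizingSolution A C R₀ Γ Q ∧ (Q⁻¹ + P₂ - P₁).PosDef) ∧
    (IsStrictlyPositive (leechOp G K) →
      IsStrictlyPositive (toeplitz (symbolR G K)) ∧
      ∀ Q, IsStabilizingSolution A C R₀ Γ Q →
        (Q⁻¹ + P₂ - P₁).PosDef ∧ IsUnit (1 + Q * (P₂ - P₁)) ∧
        ∃ Ω : Matrix (Fin n) (Fin n) ℂ,
          Ω = (P₁ - P₂) * (Q⁻¹ + P₂ - P₁)⁻¹ * Q⁻¹ ∧
          Ω = (P₁ - P₂) * (1 + Q * (P₂ - P₁))⁻¹ ∧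
          Ring.inverse (leechOp G K) =
            Ring.inverse (toeplitz (symbolR G K)) +
              Ring.inverse (toeplitz (symbolR G K)) ∘L obsOp C A hA ∘L
                Matrix.toEuclideanCLM (n := Fin n) (𝕜 := ℂ) Ω ∘L
                (obsOp C A hA).adjoint ∘L Ring.inverse (toeplitz (symbolR G K))) := by
  have hP₁' := hA.isHermitian_of_stein hP₁
  have hP₂' := hA.isHermitian_of_stein hP₂
  have hΔ : (P₁ - P₂).IsHermitian := hP₁'.sub hP₂'
  obtain ⟨g0, g1⟩ := toeplitz_lowerTriangular hA hG fun z hz => hreal.eq_left hz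
  obtain ⟨k0, k1⟩ := toeplitz_lowerTriangular hA hK fun z hz => hreal.eq_right hz
  have hTR := hasBlockForm_symbolR hG hK hreal hA hP₁ hP₂
  -- Two operators of the same block form: this is `T = L + W Δ W^*`.
  have hTL := hTR.unique (hasBlockForm_leech g0 g1 k0 k1 hP₁ hP₂ hP₁' hP₂')
  rw [← hR₀, ← hΓ] at hTR
  change _ = leechOp G K + _ at hTL
  have hLa : (leechOp G K).adjoint = leechOp G K := by
    simp only [leechOp, map_sub, ContinuousLinearMap.adjoint_comp,
      ContinuousLinearMap.adjoint_adjoint]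
  have hTa : (toeplitz (symbolR G K)).adjoint = toeplitz (symbolR G K) := by
    rw [hTL, map_add, hLa, ContinuousLinearMap.adjoint_comp, ContinuousLinearMap.adjoint_comp,
      ContinuousLinearMap.adjoint_adjoint, coefLin_adjoint, hΔ.eq, ContinuousLinearMap.comp_assoc]
  have hL := sub_eq_of_eq_add hTL |>.symm
  set T := toeplitz (symbolR G K)
  have hcomm : ∀ Q : Matrix (Fin n) (Fin n) ℂ, Q⁻¹ + P₂ - P₁ = Q⁻¹ - (P₁ - P₂) := fun Q => by abel
  have hTpos : IsStrictlyPositive (leechOp G K) → IsStrictlyPositive T := fun h => by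
    obtain ⟨ε, hε, hle⟩ := exists_le_inner_of_isStrictlyPositive h
    exact isStrictlyPositive_of_le_inner hTa hε (hTR.le_inner hTL hle)
  have hΩ : ∀ Q : Matrix (Fin n) (Fin n) ℂ, Q.PosDef → (Q⁻¹ + P₂ - P₁).PosDef →
      IsUnit (1 + Q * (P₂ - P₁)) ∧
      (P₁ - P₂) * (Q⁻¹ + P₂ - P₁)⁻¹ * Q⁻¹ = (P₁ - P₂) * (1 + Q * (P₂ - P₁))⁻¹ := fun Q hQ hY => by
    have hQu := (Matrix.isUnit_iff_isUnit_det _).1 hQ.isUnit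
    have e : 1 + Q * (P₂ - P₁) = Q * (Q⁻¹ + P₂ - P₁) := by
      rw [add_sub_assoc, Matrix.mul_add, Matrix.mul_nonsing_inv _ hQu]
    rw [e]
    exact ⟨hQ.isUnit.mul hY.isUnit, by rw [Matrix.mul_inv_rev, Matrix.mul_assoc]⟩
  have hinv : ∀ Q : Matrix (Fin n) (Fin n) ℂ, IsStabilizingSolution A C R₀ Γ Q →
      (Q⁻¹ + P₂ - P₁).PosDef → IsUnit (leechOp G K) ∧
        Ring.inverse (leechOp G K) = Ring.inverse T + Ring.inverse T ∘L obsOp C A hA ∘L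
          coefLin ((P₁ - P₂) * (1 + Q * (P₂ - P₁))⁻¹) ∘L (obsOp C A hA).adjoint ∘L
            Ring.inverse T := fun Q hQ hY => by
    obtain ⟨hT, X, hTX, hQX⟩ := hTR.isStrictlyPositive_and_eq hTa hQ
    have hu := (Matrix.isUnit_iff_isUnit_det _).1 (hΩ Q hQ.posDef hY).1
    rw [hL]
    set Z := 1 + Q * (P₂ - P₁) with hZ
    have hZ' : Z = 1 - Q * (P₁ - P₂) := by
      rw [hZ, Matrix.mul_sub, Matrix.mul_sub]
      abel
    -- The push-through identity `(1 - ΔQ) Δ = Δ (1 - QΔ)`, by which `Ω = Δ Z⁻¹` satisfies the first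
    -- Woodbury relation as well as the second.
    have hZ1 : (P₁ - P₂) - (P₁ - P₂) * Q * (P₁ - P₂) = (P₁ - P₂) * Z := by
      rw [hZ', Matrix.mul_sub (P₁ - P₂) 1, Matrix.mul_one, Matrix.mul_assoc]
    refine ringInverse_perturbation hT hTX hQX ?_ ?_
    · rw [← Matrix.mul_assoc, ← Matrix.sub_mul, hZ1, Matrix.mul_assoc,
        Matrix.mul_nonsing_inv _ hu, Matrix.mul_one]
    · rw [Matrix.mul_assoc _ Q, ← Matrix.mul_one ((P₁ - P₂) * Z⁻¹), Matrix.mul_assoc _ 1,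
        Matrix.one_mul, ← Matrix.mul_sub, ← hZ', Matrix.mul_assoc, Matrix.nonsing_inv_mul _ hu,
        Matrix.mul_one]
  have hpd : IsStrictlyPositive (leechOp G K) → ∀ Q, IsStabilizingSolution A C R₀ Γ Q →
      (Q⁻¹ + P₂ - P₁).PosDef := fun h Q hQ => by
    obtain ⟨_, X, hTX, hQX⟩ := hTR.isStrictlyPositive_and_eq hTa hQ
    rw [hL] at h
    rw [hcomm]
    exact posDef_of_isStrictlyPositive hQ.posDef hΔ hTX hQX h
  refine ⟨⟨fun h => ?_, fun ⟨Q, hQ, hY⟩ => ?_⟩, fun h => ⟨hTpos h, fun Q hQ => ?_⟩⟩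
  · obtain ⟨Q, hQ⟩ := hTR.exists_isStabilizingSolution hobs (hTpos h)
    exact ⟨Q, hQ, hpd h Q hQ⟩
  -- Invertibility comes from the Woodbury formula, so only semidefiniteness remains, and the
  -- completed square gives it.
  · refine IsStrictlyPositive.iff_of_unital.2 ⟨?_, (hinv Q hQ hY).1⟩
    obtain ⟨hT, X, hTX, hQX⟩ := hTR.isStrictlyPositive_and_eq hTa hQ
    rw [ContinuousLinearMap.nonneg_iff_isPositive, ContinuousLinearMap.isPositive_def']
    refine ⟨hLa, fun x => ?_⟩
    rw [ContinuousLinearMap.reApplyInnerSelf, hL, inner_perturbation hTa hQ.posDef hTX hQX]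
    rw [hcomm] at hY
    exact add_nonneg
      (((ContinuousLinearMap.nonneg_iff_isPositive _).1 hT.nonneg).re_inner_nonneg_left _)
      (((ContinuousLinearMap.nonneg_iff_isPositive _).1
        (isStrictlyPositive_coefLin hY).nonneg).re_inner_nonneg_left _)
  · have hY := hpd h Q hQ
    obtain ⟨hu, he⟩ := hΩ Q hQ.posDef hY
    exact ⟨hY, hu, _, he.symm, rfl, (hinv Q hQ hY).2⟩
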